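/- Theorem (Division theorem in $h_{(0,1)}(\hat D)$). Let $\mathbf{k}$ be a field and let $n, r \ge 0$ be integers. Let $h_{(0,1)}(\hat D)$ be the $\mathbf{k}$-algebra generated by $\mathbf{k}[[x]]=\mathbf{k}[[x_1,\dots,x_n]]$, $\partial_1,\dots,\partial_n$ and $h$, whose only non-trivial commutation relations are $\partial_i c(x)-c(x)\partial_i=\frac{\partial c}{\partial x_i}h$ for $c\in \mathbf{k}[[x]]$. Each element has a unique writing $P=\sum c_{\alpha,\beta,k}x^\alpha\partial^\beta h^k$ in which only finitely many $(\beta,k)$ occur. Its support is $\mathcal N(P)=\{(\alpha,\beta,k)\in\mathbb N^{2n+1} : c_{\alpha,\beta,k}\neq 0\}$, its degree is the maximum of $|\beta|+k$ over $\mathcal N(P)$, and $P$ is homogeneous if $|\beta|+k=\deg P$ for all $(\alpha,\beta,k)\in\mathcal N(P)$ (so $0$ is homogeneous). Let $\prec$ be an admissible order on $\mathbb N^{2n}$ (exponents $(\alpha,\beta)$ of the commutative monomials $x^\alpha\xi^\beta$), i.e. a total order such that $a\prec b$ implies $c+a\prec c+b$, with $x_i\prec 1$ and $x_i\xi_i\succ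 1$ for all $i$. Define a total order $\prec^h$ on $\mathbb N^{2n+1}$ by: $(\alpha,\beta,k)\prec^h(\alpha',\beta',k')$ if and only if $k+|\beta|<k'+|\beta'|$, or $k+|\beta|=k'+|\beta'|$ and $(\alpha,\beta)\prec(\alpha',\beta')$. For $P\neq0$ let $\exp_{\prec^h}(P)$ be the $\prec^h$-maximum of $\mathcal N(P)$, which exists. Let $P_1,\dots,P_r\in h_{(0,1)}(\hat D)$ be non-zero, and put $$\Delta_j=(\exp_{\prec^h}(P_j)+\mathbb N^{2n+1})\smallsetminus(\Delta_1\cup\dots\cup\Delta_{j-1})\quad(1\le j\le r),\qquad \bar\Delta=\mathbb N^{2n+1}\smallsetminus\bigcup_j\Delta_j .$$ Then for every $P\in h_{(0,1)}(\hat D)$ there is a unique $(Q_1,\dots,Q_r,R)\in h_{(0,1)}(\hat D)^{r+1}$ such that - $P=Q_1P_1+\dots+Q_rP_r+R$; - for every $j$, if $Q_j\ne0$ then $\mathcal N(Q_j)+\exp_{\prec^h}(P_j)\subset\Delta_j$; - if $R\neq 0$ then $\mathcal N(R)\subset\bar\Delta$. Moreover, if $P$ and all the $P_j$ are homogeneous,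 then so are all the $Q_j$ and $R$. -/

import Mathlib

noncomputable section

/-- The underlying left `k⟦x⟧`-module of the homogenized ring `h_(0,1)(D̂)` of formal differential
operators in `x_1, …, x_n`: finite sums `∑ c_{β,j}(x) ∂^β h^j` with `c_{β,j} ∈ k⟦x⟧`, stored through
the coefficients `c_{β,j}`. The ring structure is defined below. -/
def HDhat (k : Type*) [Field k] (n : ℕ) : Type _ :=
  ((Fin n →₀ ℕ) × ℕ) →₀ MvPowerSeries (Fin n) k

namespace HDhat

variable {k : Type*} [Field k] {n : ℕ}

instance : AddCommGroup (HDhat k n) :=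
  inferInstanceAs (AddCommGroup (((Fin n →₀ ℕ) × ℕ) →₀ MvPowerSeries (Fin n) k))

instance : Module (MvPowerSeries (Fin n) k) (HDhat k n) :=
  inferInstanceAs (Module (MvPowerSeries (Fin n) k)
    (((Fin n →₀ ℕ) × ℕ) →₀ MvPowerSeries (Fin n) k))

instance : Module k (HDhat k n) :=
  inferInstanceAs (Module k (((Fin n →₀ ℕ) × ℕ) →₀ MvPowerSeries (Fin n) k))

instance : IsScalarTower k (MvPowerSeries (Fin n) k) (HDhat k n) :=
  inferInstanceAs (IsScalarTower k (MvPowerSeries (Fin n) k)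
    (((Fin n →₀ ℕ) × ℕ) →₀ MvPowerSeries (Fin n) k))

instance : SMulCommClass k (MvPowerSeries (Fin n) k) (HDhat k n) :=
  inferInstanceAs (SMulCommClass k (MvPowerSeries (Fin n) k)
    (((Fin n →₀ ℕ) × ℕ) →₀ MvPowerSeries (Fin n) k))

/-- The element `c(x) ∂^β h^j`, with `e = (β, j)`. -/
def term (e : (Fin n →₀ ℕ) × ℕ) (c : MvPowerSeries (Fin n) k) : HDhat k n :=
  Finsupp.single e c

/-- `P` as the finitely supported family of its coefficients `c_{β,j}(x)`. -/
def toFinsupp (P : HDhat k n) : ((Fin n →₀ ℕ) × ℕ) →₀ MvPowerSeries (Fin n) k := P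

/-- The power series `c_{β,j}(x)` of `P = ∑ c_{β,j}(x) ∂^β h^j`. -/
def seriesCoeff (P : HDhat k n) (e : (Fin n →₀ ℕ) × ℕ) : MvPowerSeries (Fin n) k :=
  P.toFinsupp e

/-- Induction on finite sums of terms. -/
theorem induction_term {p : HDhat k n → Prop} (P : HDhat k n) (h0 : p 0)
    (ha : ∀ P Q, p P → p Q → p (P + Q)) (ht : ∀ e c, p (term e c)) : p P :=
  Finsupp.induction_linear P h0 ha ht

/-- The `k⟦x⟧`-linear map `c(x) ∂^β h^j ↦ c(x) ∂^(β+β') h^(j+j')`, with `e = (β', j')`. -/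
def shift (e : (Fin n →₀ ℕ) × ℕ) : HDhat k n →ₗ[MvPowerSeries (Fin n) k] HDhat k n :=
  Finsupp.lmapDomain (MvPowerSeries (Fin n) k) (MvPowerSeries (Fin n) k) (fun f => f + e)

/-- The `k`-linear map `c(x) ∂^β h^j ↦ (∂c/∂x_i)(x) ∂^β h^j`. -/
def coeffDeriv (i : Fin n) : HDhat k n →ₗ[k] HDhat k n :=
  Finsupp.mapRange.linearMap (MvPowerSeries.pderiv k i).toLinearMap

/-- Left multiplication by `∂_i`:
`∂_i · c(x) ∂^β h^j = c(x) ∂_i ∂^β h^j + (∂c/∂x_i)(x) ∂^β h^(j+1)`. -/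
def dAct (i : Fin n) : Module.End k (HDhat k n) :=
  (shift (Finsupp.single i 1, 0)).restrictScalars k +
    (shift (0, 1)).restrictScalars k ∘ₗ coeffDeriv i

/-- Left multiplication by `h^j`. -/
def hAct (j : ℕ) : Module.End k (HDhat k n) := (shift (0, j)).restrictScalars k

@[simp] theorem shift_term (e f : (Fin n →₀ ℕ) × ℕ) (c : MvPowerSeries (Fin n) k) :
    shift e (term f c) = term (f + e) c :=
  Finsupp.mapDomain_single

@[simp] theorem hAct_term (j : ℕ) (f : (Fin n →₀ ℕ) × ℕ) (c : MvPowerSeries (Fin n) k) :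
    hAct j (term f c) = term (f + (0, j)) c := shift_term _ _ _

@[simp] theorem coeffDeriv_term (i : Fin n) (f : (Fin n →₀ ℕ) × ℕ)
    (c : MvPowerSeries (Fin n) k) :
    coeffDeriv i (term f c) = term f (MvPowerSeries.pderiv k i c) :=
  Finsupp.mapRange_single (hf := map_zero _)

@[simp] theorem dAct_term (i : Fin n) (f : (Fin n →₀ ℕ) × ℕ) (c : MvPowerSeries (Fin n) k) :
    dAct i (term f c) =
      term (f + (Finsupp.single i 1, 0)) c + term (f + (0, 1)) (MvPowerSeries.pderiv k i c) := by
  simp [dAct]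

@[simp] theorem smul_term (a : MvPowerSeries (Fin n) k) (f : (Fin n →₀ ℕ) × ℕ)
    (c : MvPowerSeries (Fin n) k) : a • term f c = term f (a * c) := by
  exact Finsupp.smul_single a f c

theorem term_add (f : (Fin n →₀ ℕ) × ℕ) (c d : MvPowerSeries (Fin n) k) :
    term f (c + d) = term f c + term f d := Finsupp.single_add f c d

theorem term_zero (f : (Fin n →₀ ℕ) × ℕ) : term f (0 : MvPowerSeries (Fin n) k) = 0 :=
  Finsupp.single_zero f

theorem end_ext {f g : Module.End k (HDhat k n)} (h : ∀ e c, f (term e c) = g (term e c)) :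
    f = g := by
  ext1 P
  induction P using induction_term with
  | h0 => simp
  | ha P Q hP hQ => simp [hP, hQ]
  | ht e c => exact h e c

theorem pderiv_comm (i j : Fin n) (c : MvPowerSeries (Fin n) k) :
    MvPowerSeries.pderiv k i (MvPowerSeries.pderiv k j c) =
      MvPowerSeries.pderiv k j (MvPowerSeries.pderiv k i c) := by
  rcases eq_or_ne i j with rfl | hij
  · rfl
  · ext m
    simp only [MvPowerSeries.coeff_pderiv, Finsupp.add_apply, Finsupp.single_eq_of_ne hij,
      Finsupp.single_eq_of_ne hij.symm, add_zero]
    rw [add_right_comm]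
    ring

theorem dAct_comm (i j : Fin n) : Commute (dAct (k := k) i) (dAct j) := by
  refine end_ext fun e c => ?_
  simp only [Module.End.mul_apply, dAct_term, map_add, pderiv_comm i j]
  rw [add_right_comm e, add_right_comm e (0, 1) (Finsupp.single i 1, 0),
    add_right_comm e (0, 1) (Finsupp.single j 1, 0)]
  abel

theorem dAct_pow_comm (β : Fin n →₀ ℕ) :
    ((Finset.univ : Finset (Fin n)) : Set (Fin n)).Pairwise
      (Function.onFun Commute fun i => dAct (k := k) i ^ β i) :=
  fun i _ j _ _ => (dAct_comm i j).pow_pow (β i) (β j)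

/-- Left multiplication by `∂^β = ∂_1^{β_1} ⋯ ∂_n^{β_n}`. -/
def dPow (β : Fin n →₀ ℕ) : Module.End k (HDhat k n) :=
  Finset.univ.noncommProd (fun i => dAct i ^ β i) (dAct_pow_comm β)

/-- Left multiplication by `P = ∑ c_{β,j}(x) ∂^β h^j`. -/
def lmul (P : HDhat k n) : Module.End k (HDhat k n) :=
  P.toFinsupp.sum fun e c => c • (hAct e.2 * dPow e.1)

instance : Mul (HDhat k n) := ⟨fun P Q => lmul P Q⟩

instance : One (HDhat k n) := ⟨term 0 1⟩

theorem mul_def (P Q : HDhat k n) : P * Q = lmul P Q := rfl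

theorem one_def : (1 : HDhat k n) = term 0 1 := rfl

@[simp] theorem lmul_zero : lmul (0 : HDhat k n) = 0 := Finsupp.sum_zero_index

theorem lmul_add (P Q : HDhat k n) : lmul (P + Q) = lmul P + lmul Q :=
  Finsupp.sum_add_index' (fun _ => zero_smul _ _) (fun _ _ _ => add_smul _ _ _)

@[simp] theorem lmul_term (e : (Fin n →₀ ℕ) × ℕ) (c : MvPowerSeries (Fin n) k) :
    lmul (term e c) = c • (hAct e.2 * dPow e.1) :=
  Finsupp.sum_single_index (zero_smul _ _)

theorem hAct_add (i j : ℕ) : hAct (k := k) (n := n) (i + j) = hAct i * hAct j := by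
  refine end_ext fun e c => ?_
  simp only [Module.End.mul_apply, hAct_term, add_assoc, Prod.mk_add_mk, add_zero]
  rw [add_comm i j]

@[simp] theorem hAct_zero : hAct (k := k) (n := n) 0 = 1 := by
  refine end_ext fun e c => ?_
  simp only [hAct_term, Module.End.one_apply]
  rw [show ((0, 0) : (Fin n →₀ ℕ) × ℕ) = 0 from rfl, add_zero]

@[simp] theorem dPow_zero : dPow (k := k) (n := n) 0 = 1 := by
  simp only [dPow, Finsupp.coe_zero, Pi.zero_apply, pow_zero]
  exact (Finset.noncommProd_eq_pow_card _ _ _ 1 (fun _ _ => rfl)).trans (one_pow _)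

theorem dPow_single_add (i : Fin n) (β : Fin n →₀ ℕ) :
    dPow (k := k) (β + Finsupp.single i 1) = dAct i * dPow β := by
  unfold dPow
  rw [← Finset.mul_noncommProd_erase Finset.univ (Finset.mem_univ i) _
      (dAct_pow_comm (β + Finsupp.single i 1)),
    ← Finset.mul_noncommProd_erase Finset.univ (Finset.mem_univ i) _ (dAct_pow_comm β),
    ← mul_assoc]
  congr 1
  · rw [Finsupp.add_apply, Finsupp.single_eq_same, pow_succ']
  · refine Finset.noncommProd_congr rfl (fun j hj => ?_) _
    rw [Finsupp.add_apply, Finsupp.single_eq_of_ne (Finset.ne_of_mem_erase hj), add_zero]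

theorem dPow_single (i : Fin n) : dPow (k := k) (Finsupp.single i 1) = dAct i := by
  have h := dPow_single_add (k := k) i 0
  rwa [zero_add, dPow_zero, mul_one] at h

theorem hAct_dAct_comm (j : ℕ) (i : Fin n) : Commute (hAct (k := k) j) (dAct i) := by
  refine end_ext fun e c => ?_
  simp only [Module.End.mul_apply, dAct_term, hAct_term, map_add]
  rw [add_right_comm e, add_right_comm e (0, 1)]

theorem hAct_dPow_comm (j : ℕ) (β : Fin n →₀ ℕ) : Commute (hAct (k := k) j) (dPow β) :=
  Finset.noncommProd_commute _ _ _ _ fun i _ => (hAct_dAct_comm j i).pow_right _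

theorem hAct_smul (j : ℕ) (a : MvPowerSeries (Fin n) k) (P : HDhat k n) :
    hAct j (a • P) = a • hAct j P := (shift (0, j)).map_smul a P

theorem dAct_smul (i : Fin n) (a : MvPowerSeries (Fin n) k) (P : HDhat k n) :
    dAct i (a • P) = a • dAct i P + MvPowerSeries.pderiv k i a • hAct 1 P := by
  induction P using induction_term with
  | h0 => simp
  | ha P Q hP hQ => simp only [smul_add, map_add, hP, hQ]; abel
  | ht e c =>
    simp only [smul_term, dAct_term, hAct_term, smul_add, Derivation.leibniz, smul_eq_mul, term_add]
    rw [mul_comm c]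
    abel

theorem lmul_smul (a : MvPowerSeries (Fin n) k) (P : HDhat k n) :
    lmul (a • P) = a • lmul P := by
  induction P using induction_term with
  | h0 => simp
  | ha P Q hP hQ => simp only [smul_add, lmul_add, hP, hQ]
  | ht e c => simp only [smul_term, lmul_term, mul_smul]

theorem lmul_hAct (j : ℕ) (P : HDhat k n) : lmul (hAct j P) = hAct j * lmul P := by
  induction P using induction_term with
  | h0 => simp
  | ha P Q hP hQ => simp only [map_add, lmul_add, hP, hQ, mul_add]
  | ht e c =>
    ext1 Q
    simp only [hAct_term, lmul_term, Module.End.mul_apply, LinearMap.smul_apply, hAct_smul,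
      Prod.fst_add, Prod.snd_add, add_zero]
    rw [add_comm e.2, hAct_add, Module.End.mul_apply]

theorem lmul_dAct (i : Fin n) (P : HDhat k n) : lmul (dAct i P) = dAct i * lmul P := by
  induction P using induction_term with
  | h0 => simp
  | ha P Q hP hQ => simp only [map_add, lmul_add, hP, hQ, mul_add]
  | ht e c =>
    ext1 Q
    simp only [dAct_term, lmul_add, lmul_term, Module.End.mul_apply, LinearMap.smul_apply,
      LinearMap.add_apply, dAct_smul, Prod.fst_add, Prod.snd_add, add_zero, dPow_single_add]
    rw [add_comm e.2, hAct_add, Module.End.mul_apply, ← Module.End.mul_apply (hAct e.2) (dAct i),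
      (hAct_dAct_comm e.2 i).eq, Module.End.mul_apply]

theorem lmul_dPow (β : Fin n →₀ ℕ) (P : HDhat k n) : lmul (dPow β P) = dPow β * lmul P := by
  have key : ∀ P : HDhat k n, lmul (dPow β P) = dPow β * lmul P := by
    unfold dPow
    refine Finset.noncommProd_induction Finset.univ _ (dAct_pow_comm β)
      (fun f => ∀ P : HDhat k n, lmul (f P) = f * lmul P) ?_ ?_ ?_
    · intro f g hf hg P
      rw [Module.End.mul_apply, hf, hg, mul_assoc]
    · intro P
      rw [one_mul, Module.End.one_apply]
    · intro i _
      induction β i with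
      | zero => intro P; rw [pow_zero, one_mul, Module.End.one_apply]
      | succ m ih => intro P; rw [pow_succ', Module.End.mul_apply, lmul_dAct, ih, mul_assoc]
  exact key P

theorem lmul_mul (P Q : HDhat k n) : lmul (P * Q) = lmul P * lmul Q := by
  rw [mul_def]
  induction P using induction_term with
  | h0 => simp
  | ha P P' hP hP' => simp only [lmul_add, LinearMap.add_apply, hP, hP', add_mul]
  | ht e c =>
    simp only [lmul_term, LinearMap.smul_apply, lmul_smul, Module.End.mul_apply, lmul_hAct,
      lmul_dPow, smul_mul_assoc, mul_assoc]

theorem lmul_one : lmul (1 : HDhat k n) = 1 := by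
  simp [one_def]

theorem dPow_add (β γ : Fin n →₀ ℕ) : dPow (k := k) (β + γ) = dPow β * dPow γ := by
  unfold dPow
  rw [← Finset.noncommProd_mul_distrib _ _ _ _
    (fun i _ j _ _ => (dAct_comm i j).pow_pow (γ i) (β j))]
  refine Finset.noncommProd_congr rfl (fun j _ => ?_) _
  rw [Finsupp.add_apply, Pi.mul_apply, pow_add]

theorem dPow_term_one (β : Fin n →₀ ℕ) (f : (Fin n →₀ ℕ) × ℕ) :
    dPow β (term f (1 : MvPowerSeries (Fin n) k)) = term (f + (β, 0)) 1 := by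
  induction β using Finsupp.induction_linear generalizing f with
  | zero =>
    rw [dPow_zero, Module.End.one_apply, show ((0, 0) : (Fin n →₀ ℕ) × ℕ) = 0 from rfl, add_zero]
  | add β γ hβ hγ =>
    rw [dPow_add, Module.End.mul_apply, hγ, hβ, add_assoc, add_comm β γ]
    rfl
  | single i m =>
    induction m generalizing f with
    | zero =>
      rw [Finsupp.single_zero, dPow_zero, Module.End.one_apply,
        show ((0, 0) : (Fin n →₀ ℕ) × ℕ) = 0 from rfl, add_zero]
    | succ m ih =>
      rw [Finsupp.single_add, dPow_single_add, Module.End.mul_apply, ih, dAct_term,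
        Derivation.map_one_eq_zero, add_assoc, term_zero, add_zero]
      rfl

instance : Ring (HDhat k n) :=
  { (inferInstance : AddCommGroup (HDhat k n)) with
    mul_assoc := fun P Q R => by
      rw [mul_def, lmul_mul, Module.End.mul_apply, ← mul_def, ← mul_def]
    one_mul := fun P => by rw [mul_def, lmul_one, Module.End.one_apply]
    mul_one := fun P => by
      rw [mul_def, one_def]
      induction P using induction_term with
      | h0 => rw [lmul_zero, LinearMap.zero_apply]
      | ha P Q hP hQ => rw [lmul_add, LinearMap.add_apply, hP, hQ]
      | ht e c =>
        rw [lmul_term, LinearMap.smul_apply, Module.End.mul_apply, dPow_term_one, hAct_term,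
          smul_term, mul_one, zero_add, Prod.mk_add_mk, add_zero, zero_add]
    zero_mul := fun P => by rw [mul_def, lmul_zero, LinearMap.zero_apply]
    mul_zero := fun P => by rw [mul_def, map_zero]
    left_distrib := fun P Q R => map_add (lmul P) Q R
    right_distrib := fun P Q R => by
      simp only [mul_def, lmul_add, LinearMap.add_apply] }

instance : Algebra k (HDhat k n) :=
  Algebra.ofModule
    (fun a P Q => by
      simp only [mul_def, ← algebraMap_smul (MvPowerSeries (Fin n) k) a, lmul_smul,
        LinearMap.smul_apply])
    (fun a P Q => (lmul P).map_smul a Q)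

/-- The inclusion of the power series ring `k⟦x⟧`. -/
def ofSeries : MvPowerSeries (Fin n) k →+* HDhat k n where
  toFun c := term 0 c
  map_one' := rfl
  map_mul' c d := by
    rw [mul_def, lmul_term, LinearMap.smul_apply, Module.End.mul_apply, Prod.fst_zero,
      Prod.snd_zero, dPow_zero, hAct_zero, Module.End.one_apply, Module.End.one_apply, smul_term]
  map_zero' := Finsupp.single_zero 0
  map_add' c d := term_add 0 c d

/-- The generator `∂_i`. -/
def del (i : Fin n) : HDhat k n := term (Finsupp.single i 1, 0) 1

/-- The generator `h`. -/
def hVar : HDhat k n := term (0, 1) 1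

theorem ofSeries_mul (c : MvPowerSeries (Fin n) k) (P : HDhat k n) : ofSeries c * P = c • P := by
  change lmul (term 0 c) P = _
  simp

theorem del_mul (i : Fin n) (P : HDhat k n) : del i * P = dAct i P := by
  simp [mul_def, del, dPow_single]

theorem hVar_mul (P : HDhat k n) : hVar * P = hAct 1 P := by
  simp [mul_def, hVar]

/-- The commutation relation `∂_i c - c ∂_i = (∂c/∂x_i) h`. -/
theorem del_mul_ofSeries (i : Fin n) (c : MvPowerSeries (Fin n) k) :
    del i * ofSeries c - ofSeries c * del i = ofSeries (MvPowerSeries.pderiv k i c) * hVar := by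
  rw [del_mul, ofSeries_mul, ofSeries_mul]
  change dAct i (term 0 c) - c • term _ 1 = _ • term _ 1
  simp

/-- The derivations `∂_i` commute with each other. -/
theorem del_mul_del (i j : Fin n) : (del i * del j : HDhat k n) = del j * del i := by
  rw [del_mul, del_mul, del, del, dAct_term, dAct_term, Derivation.map_one_eq_zero,
    Derivation.map_one_eq_zero, term_zero, term_zero, add_comm (Finsupp.single j 1, 0)]

/-- The variable `h` is central. -/
theorem hVar_mul_comm (P : HDhat k n) : hVar * P = P * hVar := by
  have h1 : (hVar : HDhat k n) = hAct 1 1 := by simp [one_def, hVar]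
  have h2 : ∀ P Q : HDhat k n, P * hAct 1 Q = hAct 1 (P * Q) := fun P Q => by
    simp only [mul_def]
    induction P using induction_term with
    | h0 => simp
    | ha P P' hP hP' => simp only [map_add, lmul_add, LinearMap.add_apply, hP, hP']
    | ht e c =>
      simp only [lmul_term, LinearMap.smul_apply, hAct_smul, ← Module.End.mul_apply]
      rw [mul_assoc, ← (hAct_dPow_comm 1 e.1).eq, ← mul_assoc, ← hAct_add, ← mul_assoc,
        ← hAct_add, add_comm]
  rw [hVar_mul, h1, h2, mul_one]

theorem del_pow_comm (β : Fin n →₀ ℕ) :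
    ((Finset.univ : Finset (Fin n)) : Set (Fin n)).Pairwise
      (Function.onFun Commute fun i => (del i : HDhat k n) ^ β i) :=
  fun i _ j _ _ => Commute.pow_pow (show Commute _ _ from del_mul_del i j) (β i) (β j)

/-- `term (β, j) c` is the product `c(x) ∂_1^{β_1} ⋯ ∂_n^{β_n} h^j` in the ring, so that every
element has a unique writing as a finite sum of such products. -/
theorem term_eq_prod (e : (Fin n →₀ ℕ) × ℕ) (c : MvPowerSeries (Fin n) k) :
    term e c = ofSeries c * (Finset.univ.noncommProd (fun i => (del i : HDhat k n) ^ e.1 i)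
      (del_pow_comm e.1)) * hVar ^ e.2 := by
  let L : HDhat k n →* Module.End k (HDhat k n) :=
    { toFun := lmul, map_one' := lmul_one, map_mul' := lmul_mul }
  have hL : ∀ P Q : HDhat k n, P * Q = L P Q := fun _ _ => rfl
  have hdel : ∀ i, L (del i) = dAct i := fun i => LinearMap.ext fun P => del_mul i P
  have hh : ∀ j : ℕ, (hVar : HDhat k n) ^ j = term (0, j) 1 := fun j => by
    induction j with
    | zero => rfl
    | succ j ih =>
      rw [pow_succ', ih, hVar_mul, hAct_term, Prod.mk_add_mk, add_zero]
  rw [mul_assoc, ofSeries_mul, hh, hL, Finset.map_noncommProd]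
  simp only [map_pow, hdel]
  change term e c = c • dPow e.1 (term (0, e.2) 1)
  rw [dPow_term_one, smul_term, mul_one, Prod.mk_add_mk, zero_add, add_zero]

/-- The coefficient `c_{α,β,j} ∈ k` of `P = ∑ c_{α,β,j} x^α ∂^β h^j`. -/
def coeff (e : (Fin n →₀ ℕ) × (Fin n →₀ ℕ) × ℕ) (P : HDhat k n) : k :=
  MvPowerSeries.coeff e.1 (P.seriesCoeff e.2)

/-- The support of `P`: the set of `(α, β, j)` with `c_{α,β,j} ≠ 0`. -/
def supp (P : HDhat k n) : Set ((Fin n →₀ ℕ) × (Fin n →₀ ℕ) × ℕ) :=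
  {e | coeff e P ≠ 0}

/-- The degree of `P`: the maximum of `|β| + j` over the support of `P` (and `0` if `P = 0`). -/
def deg (P : HDhat k n) : ℕ :=
  P.toFinsupp.support.sup
    fun e => e.1.degree + e.2

/-- `P` is homogeneous if `|β| + j = deg P` for all `(α, β, j)` in the support of `P`. -/
def IsHomogeneous (P : HDhat k n) : Prop :=
  ∀ e ∈ P.supp, e.2.1.degree + e.2.2 = P.deg

end HDhat

/-- A (local) admissible order on `ℕ^{2n}`, given by its strict relation `lt`, written on the
exponents `(α, β)` of the commutative monomials `x^α ξ^β`: a strict total order, compatible with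
addition, with `x_i ≺ 1` and `1 ≺ x_i ξ_i` for every `i`. -/
structure IsAdmissibleOrder {n : ℕ}
    (lt : (Fin n →₀ ℕ) × (Fin n →₀ ℕ) → (Fin n →₀ ℕ) × (Fin n →₀ ℕ) → Prop) : Prop where
  strictTotal : IsStrictTotalOrder _ lt
  add_left : ∀ a b c, lt a b → lt (c + a) (c + b)
  x_lt_one : ∀ i, lt (Finsupp.single i 1, 0) 0
  one_lt_x_xi : ∀ i, lt 0 (Finsupp.single i 1, Finsupp.single i 1)

/-- The order `≺^h` on `ℕ^{2n+1}`: compare `j + |β|` first and then `(α, β)` by `≺`. -/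
def ltHom {n : ℕ}
    (lt : (Fin n →₀ ℕ) × (Fin n →₀ ℕ) → (Fin n →₀ ℕ) × (Fin n →₀ ℕ) → Prop)
    (e f : (Fin n →₀ ℕ) × (Fin n →₀ ℕ) × ℕ) : Prop :=
  e.2.2 + e.2.1.degree < f.2.2 + f.2.1.degree ∨
    (e.2.2 + e.2.1.degree = f.2.2 + f.2.1.degree ∧ lt (e.1, e.2.1) (f.1, f.2.1))

namespace HDhat

variable {k : Type*} [Field k] {n : ℕ}

/-- `e` is the maximum of the support of `P` for `≺^h`. -/
def IsLeadExp (lt : (Fin n →₀ ℕ) × (Fin n →₀ ℕ) → (Fin n →₀ ℕ) × (Fin n →₀ ℕ) → Prop)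
    (P : HDhat k n) (e : (Fin n →₀ ℕ) × (Fin n →₀ ℕ) × ℕ) : Prop :=
  e ∈ P.supp ∧ ∀ f ∈ P.supp, f ≠ e → ltHom lt f e

open Classical in
/-- The leading exponent of `P` for `≺^h`: the maximum of its support. It exists and is unique for
`P ≠ 0` and `≺` admissible; the value is `0` if there is no maximum. -/
def leadExp (lt : (Fin n →₀ ℕ) × (Fin n →₀ ℕ) → (Fin n →₀ ℕ) × (Fin n →₀ ℕ) → Prop)
    (P : HDhat k n) : (Fin n →₀ ℕ) × (Fin n →₀ ℕ) × ℕ :=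
  if h : ∃ e, P.IsLeadExp lt e then h.choose else 0

theorem exists_isLeadExp
    {lt : (Fin n →₀ ℕ) × (Fin n →₀ ℕ) → (Fin n →₀ ℕ) × (Fin n →₀ ℕ) → Prop}
    (hlt : IsAdmissibleOrder lt) {P : HDhat k n} (hP : P ≠ 0) : ∃ e, P.IsLeadExp lt e := by
  have hto := hlt.strictTotal
  -- adding to the exponent of `x` makes the exponent smaller
  have hle : ∀ δ α β : Fin n →₀ ℕ, δ = 0 ∨ lt (δ + α, β) (α, β) := fun δ => by
    induction δ using Finsupp.induction_linear with
    | zero => exact fun _ _ => Or.inl rfl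
    | add δ ε hδ hε =>
      intro α β
      rcases hδ (ε + α) β with rfl | h
      · simpa using hε α β
      · rcases hε α β with rfl | h'
        · simp only [zero_add] at h
          right
          simpa using h
        · right
          rw [add_assoc]
          exact hto.trans _ _ _ h h'
    | single i m =>
      intro α β
      induction m with
      | zero => simp
      | succ m ih =>
        right
        have h := hlt.add_left _ _ (Finsupp.single i m + α, β) (hlt.x_lt_one i)
        rw [add_zero, Prod.mk_add_mk, add_zero, add_right_comm, ← Finsupp.single_add] at h
        rcases ih with h0 | h1
        · rwa [h0, zero_add] at h
        · exact hto.trans _ _ _ h h1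
  have hso : IsStrictOrder _ (fun a b => ltHom lt b a) :=
    { irrefl := fun a h => by
        rcases h with h | h
        · exact lt_irrefl _ h
        · exact hto.irrefl _ h.2
      trans := fun a b c h1 h2 => by
        rcases h1 with h1 | h1 <;> rcases h2 with h2 | h2
        · exact Or.inl (h2.trans h1)
        · exact Or.inl (h2.1.trans_lt h1)
        · exact Or.inl (h2.trans_eq h1.1)
        · exact Or.inr ⟨h2.1.trans h1.1, hto.trans _ _ _ h2.2 h1.2⟩ }
  have hwf : P.supp.WellFoundedOn (fun a b => ltHom lt b a) := by
    refine Set.WellFoundedOn.subset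
      (t := ⋃ e ∈ P.toFinsupp.support,
        {f : (Fin n →₀ ℕ) × (Fin n →₀ ℕ) × ℕ | f.2 = e})
      ((Finset.wellFoundedOn_bUnion _).2 fun e _ => ?_) ?_
    · rw [Set.wellFoundedOn_iff_no_descending_seq]
      intro g hg
      obtain ⟨a, b, hab, hle'⟩ :=
        wellQuasiOrdered_le (α := Fin n →₀ ℕ) fun m => (g m).1
      have h1 : ltHom lt (g a) (g b) := g.map_rel_iff.2 hab
      have ha : (g a).2 = e := hg a
      have hb : (g b).2 = e := hg b
      have h2 : lt ((g a).1, e.1) ((g b).1, e.1) := by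
        rcases h1 with h1 | h1
        · rw [ha, hb] at h1
          exact absurd h1 (lt_irrefl _)
        · rw [ha, hb] at h1
          exact h1.2
      obtain ⟨δ, hδ⟩ := exists_add_of_le hle'
      rw [show (g b).1 = δ + (g a).1 from hδ.trans (add_comm _ _)] at h2
      rcases hle δ (g a).1 e.1 with h0 | h0
      · rw [h0, zero_add] at h2
        exact hto.irrefl _ h2
      · exact hto.irrefl _ (hto.trans _ _ _ h2 h0)
    · intro f hf
      refine Set.mem_iUnion₂.2 ⟨f.2, Finsupp.mem_support_iff.2 fun h0 => ?_, rfl⟩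
      refine hf ?_
      change MvPowerSeries.coeff f.1 (P.seriesCoeff f.2) = 0
      rw [show P.seriesCoeff f.2 = 0 from h0, map_zero]
  have hne : P.supp.Nonempty := by
    by_contra hemp
    refine hP (Finsupp.ext (f := P.toFinsupp) (g := 0) fun e => MvPowerSeries.ext fun α => ?_)
    by_contra h
    exact hemp ⟨(α, e), h⟩
  obtain ⟨⟨e, he⟩, -, hmin⟩ := hwf.has_min Set.univ
    (Set.nonempty_iff_univ_nonempty.1 hne.to_subtype)
  refine ⟨e, he, fun f hf hfe => ?_⟩
  have hnot : ¬ ltHom lt e f := hmin ⟨f, hf⟩ trivial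
  rcases lt_trichotomy (f.2.2 + f.2.1.degree) (e.2.2 + e.2.1.degree) with h | h | h
  · exact Or.inl h
  · refine Or.inr ⟨h, ?_⟩
    by_contra h1
    have h2 : ¬ lt (e.1, e.2.1) (f.1, f.2.1) := fun h3 => hnot (Or.inr ⟨h.symm, h3⟩)
    have h4 := hto.trichotomous _ _ h1 h2
    obtain ⟨α, β, j⟩ := e
    obtain ⟨α', β', j'⟩ := f
    simp only [Prod.mk.injEq] at h4 h
    obtain ⟨rfl, rfl⟩ := h4
    exact hfe (by rw [add_right_cancel h])
  · exact absurd (Or.inl h) hnot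

/-- For `P ≠ 0` the leading exponent is the maximum of the support. -/
theorem isLeadExp_leadExp
    {lt : (Fin n →₀ ℕ) × (Fin n →₀ ℕ) → (Fin n →₀ ℕ) × (Fin n →₀ ℕ) → Prop}
    (hlt : IsAdmissibleOrder lt) {P : HDhat k n} (hP : P ≠ 0) :
    P.IsLeadExp lt (P.leadExp lt) := by
  rw [leadExp, dif_pos (exists_isLeadExp hlt hP)]
  exact (exists_isLeadExp hlt hP).choose_spec

end HDhat

/-- `Δ_j = (e_j + ℕ^{2n+1}) ∖ (Δ_1 ∪ ⋯ ∪ Δ_{j-1})`, where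
`Δ_1 ∪ ⋯ ∪ Δ_{j-1} = ⋃_{i<j} (e_i + ℕ^{2n+1})`. -/
def divisionCell {n r : ℕ} (e : Fin r → (Fin n →₀ ℕ) × (Fin n →₀ ℕ) × ℕ) (j : Fin r) :
    Set ((Fin n →₀ ℕ) × (Fin n →₀ ℕ) × ℕ) :=
  {f | (∃ g, f = e j + g) ∧ ∀ i < j, ¬ ∃ g, f = e i + g}

/-- `Δ̄ = ℕ^{2n+1} ∖ (Δ_1 ∪ ⋯ ∪ Δ_r)`. -/
def remainderCell {n r : ℕ} (e : Fin r → (Fin n →₀ ℕ) × (Fin n →₀ ℕ) × ℕ) :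
    Set ((Fin n →₀ ℕ) × (Fin n →₀ ℕ) × ℕ) :=
  {f | ∀ j, f ∉ divisionCell e j}

/-- `(Q_1, …, Q_r, R)` is a division of `P` by `P_1, …, P_r` with respect to `≺^h`. -/
structure IsDivision {k : Type*} [Field k] {n r : ℕ}
    (lt : (Fin n →₀ ℕ) × (Fin n →₀ ℕ) → (Fin n →₀ ℕ) × (Fin n →₀ ℕ) → Prop)
    (D : Fin r → HDhat k n) (P : HDhat k n) (Q : Fin r → HDhat k n) (R : HDhat k n) : Prop where
  eq_sum_add : P = (∑ j, Q j * D j) + R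
  quotient_supp : ∀ j, Q j ≠ 0 → ∀ f ∈ (Q j).supp,
    f + (D j).leadExp lt ∈ divisionCell (fun i => (D i).leadExp lt) j
  remainder_supp : R ≠ 0 → R.supp ⊆ remainderCell (fun i => (D i).leadExp lt)

end

/-! Moving `∂^β` past `x^α` gives `x^α ∂^β` plus terms in which `γ ≠ 0` pairs `x ∂` have been traded
for `h^|γ|` (`IsContraction`). A contraction keeps `|β| + j` and divides `x^α ξ^β` by `x^γ ξ^γ ≻ 1`,
so it strictly lowers the exponent for `≺^h`. Hence leading exponents add and leading coefficients
multiply, as in a commutative ring (`exists_of_mem_supp_mul_leadExp`, `coeff_mul_leadExp`).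

The cells `Δ_j` and `Δ̄` partition the exponents. A candidate division in degree at most `d = deg P`
is therefore a single function `u`: its value at `e ∈ Δ_j` is the coefficient of `Q_j` at `e -
exp(P_j)`, and at `e ∈ Δ̄` the coefficient of `R` at `e`. The equation `∑ Q_j P_j + R = P` is linear
in `u` and triangular: if `u` vanishes above `e`, the coefficient at `e` is `u e` times the leading
coefficient of `P_j`, or times `1` on `Δ̄`. In bounded degree `≺^h` has no infinite increasing
sequence (Dickson's lemma and `x_i ≺ 1`), so the system is solved from the top down
(`exists_solution_of_triangular`). Any function of `α` is a power series, so no convergence question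
arises.

Triangularity gives uniqueness as well: in a nontrivial division of `0`, the largest exponent could
not cancel. For homogeneous data, keeping only the expected degrees of a division gives another
division, which uniqueness identifies with the original. -/

namespace HDhat

/-! ### Coefficients and supports under the elementary operations. -/

variable {k : Type*} [Field k] {n : ℕ}

/-- The coefficient at `e` as a `k`-linear form. -/
noncomputable def coeffLin (e : (Fin n →₀ ℕ) × (Fin n →₀ ℕ) × ℕ) : HDhat k n →ₗ[k] k :=
  (MvPowerSeries.coeff (R := k) e.1) ∘ₗ Finsupp.lapply e.2

@[simp] theorem coeff_zero (e : (Fin n →₀ ℕ) × (Fin n →₀ ℕ) × ℕ) :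
    coeff e (0 : HDhat k n) = 0 := map_zero (coeffLin e)

@[simp] theorem coeff_add (e : (Fin n →₀ ℕ) × (Fin n →₀ ℕ) × ℕ) (P Q : HDhat k n) :
    coeff e (P + Q) = coeff e P + coeff e Q := map_add (coeffLin e) P Q

@[simp] theorem coeff_sub (e : (Fin n →₀ ℕ) × (Fin n →₀ ℕ) × ℕ) (P Q : HDhat k n) :
    coeff e (P - Q) = coeff e P - coeff e Q := map_sub (coeffLin e) P Q

theorem coeff_sum {ι : Type*} (e : (Fin n →₀ ℕ) × (Fin n →₀ ℕ) × ℕ) (s : Finset ι)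
    (P : ι → HDhat k n) : coeff e (∑ i ∈ s, P i) = ∑ i ∈ s, coeff e (P i) :=
  map_sum (coeffLin e) P s

theorem coeff_ext {P Q : HDhat k n} (h : ∀ e, coeff e P = coeff e Q) : P = Q :=
  Finsupp.ext (f := P.toFinsupp) (g := Q.toFinsupp) fun e =>
    MvPowerSeries.ext fun α => h (α, e)

theorem mem_supp {e : (Fin n →₀ ℕ) × (Fin n →₀ ℕ) × ℕ} {P : HDhat k n} :
    e ∈ P.supp ↔ coeff e P ≠ 0 := Iff.rfl

theorem mem_supp_of_mem_supp_add {e : (Fin n →₀ ℕ) × (Fin n →₀ ℕ) × ℕ} {P Q : HDhat k n}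
    (h : e ∈ (P + Q).supp) : e ∈ P.supp ∨ e ∈ Q.supp := by
  by_contra! h'
  simp only [mem_supp, not_not] at h'
  exact h (by rw [coeff_add, h'.1, h'.2, add_zero])

theorem eq_zero_of_supp {P : HDhat k n} (h : ∀ e, e ∉ P.supp) : P = 0 :=
  coeff_ext fun e => by simpa [mem_supp] using h e

/-- The monomial `c x^α ∂^β h^j`, with `e = (α, β, j)`. -/
noncomputable def mono (e : (Fin n →₀ ℕ) × (Fin n →₀ ℕ) × ℕ) (c : k) : HDhat k n :=
  term e.2 (MvPowerSeries.monomial e.1 c)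

open scoped Classical in
theorem coeff_mono (e f : (Fin n →₀ ℕ) × (Fin n →₀ ℕ) × ℕ) (c : k) :
    coeff f (mono e c) = if f = e then c else 0 := by
  change MvPowerSeries.coeff f.1 ((Finsupp.single e.2 (MvPowerSeries.monomial e.1 c)) f.2) = _
  rw [Finsupp.single_apply]
  obtain ⟨α, b⟩ := e
  obtain ⟨α', b'⟩ := f
  by_cases hb : b = b'
  · subst hb
    simp [MvPowerSeries.coeff_monomial]
  · simp [hb, Ne.symm hb]

theorem eq_of_mem_supp_mono {e f : (Fin n →₀ ℕ) × (Fin n →₀ ℕ) × ℕ} {c : k}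
    (h : f ∈ (mono e c).supp) : f = e := by
  classical
  rw [mem_supp, coeff_mono] at h
  by_contra h'
  exact h (if_neg h')

theorem mem_supp_sub_mono {e f : (Fin n →₀ ℕ) × (Fin n →₀ ℕ) × ℕ} {P : HDhat k n}
    (h : f ∈ (P - mono e (coeff e P)).supp) : f ∈ P.supp ∧ f ≠ e := by
  classical
  rw [mem_supp, coeff_sub, coeff_mono] at h
  by_cases hf : f = e
  · subst hf
    simp at h
  · rw [if_neg hf, sub_zero] at h
    exact ⟨h, hf⟩

theorem exists_of_mem_supp_shift {s : (Fin n →₀ ℕ) × ℕ} {P : HDhat k n}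
    {e : (Fin n →₀ ℕ) × (Fin n →₀ ℕ) × ℕ} (h : e ∈ (shift s P).supp) :
    ∃ f ∈ P.supp, e = (f.1, f.2 + s) := by
  by_cases hs : ∃ b, b + s = e.2
  · obtain ⟨b, hb⟩ := hs
    refine ⟨(e.1, b), ?_, by rw [hb]⟩
    have h1 : (shift s P).seriesCoeff (b + s) = P.seriesCoeff b :=
      Finsupp.mapDomain_apply (f := fun f => f + s) (add_left_injective s) P.toFinsupp b
    rw [mem_supp, coeff, ← hb, h1] at h
    exact h
  · refine absurd ?_ h
    have h1 : (shift s P).seriesCoeff e.2 = 0 :=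
      Finsupp.mapDomain_of_notMem_range (f := fun f => f + s) P.toFinsupp e.2
        (fun ⟨b, hb⟩ => hs ⟨b, hb⟩)
    rw [coeff, h1, map_zero]

theorem mem_supp_of_mem_supp_coeffDeriv {i : Fin n} {P : HDhat k n}
    {e : (Fin n →₀ ℕ) × (Fin n →₀ ℕ) × ℕ} (h : e ∈ (coeffDeriv i P).supp) :
    (e.1 + Finsupp.single i 1, e.2) ∈ P.supp := by
  have h1 : (coeffDeriv i P).seriesCoeff e.2 = MvPowerSeries.pderiv k i (P.seriesCoeff e.2) := rfl
  rw [mem_supp, coeff, h1, MvPowerSeries.coeff_pderiv] at h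
  intro h0
  refine h ?_
  change MvPowerSeries.coeff (e.1 + Finsupp.single i 1) (P.seriesCoeff e.2) = 0 at h0
  simp [h0]

theorem exists_of_mem_supp_smul {c : MvPowerSeries (Fin n) k} {P : HDhat k n}
    {e : (Fin n →₀ ℕ) × (Fin n →₀ ℕ) × ℕ} (h : e ∈ (c • P).supp) :
    ∃ δ, MvPowerSeries.coeff δ c ≠ 0 ∧ ∃ f ∈ P.supp, e = (δ + f.1, f.2) := by
  classical
  have h1 : (c • P).seriesCoeff e.2 = c * P.seriesCoeff e.2 := rfl
  rw [mem_supp, coeff, h1, MvPowerSeries.coeff_mul] at h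
  obtain ⟨p, hp, hne⟩ := Finset.exists_ne_zero_of_sum_ne_zero h
  refine ⟨p.1, left_ne_zero_of_mul hne, (p.2, e.2), right_ne_zero_of_mul hne, ?_⟩
  rw [Finset.HasAntidiagonal.mem_antidiagonal.1 hp]

/-! ### Contractions and the support of a product. -/

/-- `e` arises from `f` by replacing `γ` factors `∂ x` by `h`: if `f = (α + γ, β + γ, j)` then
`e = (α, β, j + |γ|)`. -/
def IsContraction (γ : Fin n →₀ ℕ) (e f : (Fin n →₀ ℕ) × (Fin n →₀ ℕ) × ℕ) : Prop :=
  f.1 = e.1 + γ ∧ f.2.1 = e.2.1 + γ ∧ e.2.2 = f.2.2 + γ.degree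

theorem IsContraction.refl (e : (Fin n →₀ ℕ) × (Fin n →₀ ℕ) × ℕ) : IsContraction 0 e e := by
  simp [IsContraction]

theorem IsContraction.trans {γ δ : Fin n →₀ ℕ} {e f g : (Fin n →₀ ℕ) × (Fin n →₀ ℕ) × ℕ}
    (h : IsContraction γ e f) (h' : IsContraction δ f g) : IsContraction (γ + δ) e g := by
  obtain ⟨h1, h2, h3⟩ := h
  obtain ⟨h4, h5, h6⟩ := h'
  refine ⟨by rw [h4, h1, add_assoc], by rw [h5, h2, add_assoc], ?_⟩
  rw [h3, h6, map_add]
  ring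

theorem IsContraction.add_left {γ : Fin n →₀ ℕ} {e f : (Fin n →₀ ℕ) × (Fin n →₀ ℕ) × ℕ}
    (h : IsContraction γ e f) (g : (Fin n →₀ ℕ) × (Fin n →₀ ℕ) × ℕ) :
    IsContraction γ (g + e) (g + f) := by
  obtain ⟨h1, h2, h3⟩ := h
  refine ⟨?_, ?_, ?_⟩ <;>
    simp only [Prod.fst_add, Prod.snd_add, h1, h2, h3, add_assoc]

theorem IsContraction.eq_zero {γ : Fin n →₀ ℕ} {e : (Fin n →₀ ℕ) × (Fin n →₀ ℕ) × ℕ}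
    (h : IsContraction γ e e) : γ = 0 := by
  simpa using h.1

theorem IsContraction.eq_of_zero {e f : (Fin n →₀ ℕ) × (Fin n →₀ ℕ) × ℕ}
    (h : IsContraction 0 e f) : e = f := by
  obtain ⟨h1, h2, h3⟩ := h
  simp only [add_zero, map_zero] at h1 h2 h3
  exact Prod.ext h1.symm (Prod.ext h2.symm h3)

theorem IsContraction.degree_eq {γ : Fin n →₀ ℕ} {e f : (Fin n →₀ ℕ) × (Fin n →₀ ℕ) × ℕ}
    (h : IsContraction γ e f) : e.2.2 + e.2.1.degree = f.2.2 + f.2.1.degree := by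
  rw [h.2.2, h.2.1, map_add]
  ring

/-- The operator `∂^β` is the shift by `∂^β` up to proper contractions. -/
theorem exists_of_mem_supp_dPow_sub (β : Fin n →₀ ℕ) : ∀ (P : HDhat k n)
    (e : (Fin n →₀ ℕ) × (Fin n →₀ ℕ) × ℕ), e ∈ (dPow β P - shift (β, 0) P).supp →
    ∃ f ∈ P.supp, ∃ γ ≠ 0, IsContraction γ e ((0, β, 0) + f) := by
  -- The property is additive in `β`, which reduces the induction to a single `∂_i`.
  have hadd : ∀ β β' : Fin n →₀ ℕ,
      (∀ (P : HDhat k n) e, e ∈ (dPow β P - shift (β, 0) P).supp →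
        ∃ f ∈ P.supp, ∃ γ ≠ 0, IsContraction γ e ((0, β, 0) + f)) →
      (∀ (P : HDhat k n) e, e ∈ (dPow β' P - shift (β', 0) P).supp →
        ∃ f ∈ P.supp, ∃ γ ≠ 0, IsContraction γ e ((0, β', 0) + f)) →
      (∀ (P : HDhat k n) e, e ∈ (dPow (β + β') P - shift (β + β', 0) P).supp →
        ∃ f ∈ P.supp, ∃ γ ≠ 0, IsContraction γ e ((0, β + β', 0) + f)) := by
    intro β β' h h' P e he
    have hsplit : ∀ f : (Fin n →₀ ℕ) × (Fin n →₀ ℕ) × ℕ,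
        ((0, β + β', 0) + f) = (0, β, 0) + ((0, β', 0) + f) := fun f => by
      rw [← add_assoc]; simp
    have hsh : ∀ P : HDhat k n, shift (β + β', 0) P = shift (β, 0) (shift (β', 0) P) := by
      intro P
      induction P using induction_term with
      | h0 => simp
      | ha P Q hP hQ => simp only [map_add, hP, hQ]
      | ht e c => simp [add_assoc, add_comm β]
    -- The error of a composite is the error of the outer operator plus the shifted error of the
    -- inner one.
    have heq : dPow (β + β') P - shift (β + β', 0) P =
        (dPow β (dPow β' P) - shift (β, 0) (dPow β' P)) +
          shift (β, 0) (dPow β' P - shift (β', 0) P) := by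
      rw [dPow_add, hsh, Module.End.mul_apply, map_sub]
      abel
    rw [heq] at he
    rcases mem_supp_of_mem_supp_add he with he | he
    · obtain ⟨f, hf, γ, hγ, hc⟩ := h _ _ he
      rw [← sub_add_cancel (dPow β' P) (shift (β', 0) P)] at hf
      rcases mem_supp_of_mem_supp_add hf with hf | hf
      · obtain ⟨g, hg, δ, -, hd⟩ := h' _ _ hf
        refine ⟨g, hg, γ + δ, ?_, ?_⟩
        · simp [hγ]
        · rw [hsplit]
          exact hc.trans (hd.add_left _)
      · obtain ⟨g, hg, rfl⟩ := exists_of_mem_supp_shift hf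
        refine ⟨g, hg, γ, hγ, ?_⟩
        rw [hsplit]
        convert hc using 2
        ext <;> simp [add_comm]
    · obtain ⟨f, hf, rfl⟩ := exists_of_mem_supp_shift he
      obtain ⟨g, hg, γ, hγ, hc⟩ := h' _ _ hf
      refine ⟨g, hg, γ, hγ, ?_⟩
      rw [hsplit]
      convert hc.add_left (0, β, 0) using 1
      ext <;> simp [add_comm]
  have hzero : ∀ (P : HDhat k n) e, e ∈ (dPow 0 P - shift (0, 0) P).supp →
      ∃ f ∈ P.supp, ∃ γ ≠ 0, IsContraction γ e ((0, 0, 0) + f) := by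
    intro P e he
    rw [show shift (0, 0) P = P from LinearMap.congr_fun (hAct_zero (k := k) (n := n)) P,
      dPow_zero, Module.End.one_apply, sub_self] at he
    exact absurd (coeff_zero e) he
  induction β using Finsupp.induction_linear with
  | zero => exact hzero
  | add β β' h h' => exact hadd β β' h h'
  | single i m =>
    induction m with
    | zero =>
      rw [Finsupp.single_zero]
      exact hzero
    | succ m ih =>
      rw [Finsupp.single_add]
      refine hadd _ _ ih fun P e he => ?_
      -- For one `∂_i` the error is `h · ∂P/∂x_i`, whose exponents are contractions by exactly one
      -- pair `x_i ∂_i`.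
      have h1 : dPow (Finsupp.single i 1) P - shift (Finsupp.single i 1, 0) P =
          shift (0, 1) (coeffDeriv i P) := by
        rw [dPow_single]
        exact add_sub_cancel_left _ _
      rw [h1] at he
      obtain ⟨f, hf, rfl⟩ := exists_of_mem_supp_shift he
      refine ⟨_, mem_supp_of_mem_supp_coeffDeriv hf, Finsupp.single i 1, by simp, ?_⟩
      refine ⟨?_, ?_, ?_⟩ <;> simp [add_comm]

theorem exists_of_mem_supp_dPow {β : Fin n →₀ ℕ} {P : HDhat k n}
    {e : (Fin n →₀ ℕ) × (Fin n →₀ ℕ) × ℕ} (he : e ∈ (dPow β P).supp) :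
    ∃ f ∈ P.supp, ∃ γ, IsContraction γ e ((0, β, 0) + f) := by
  rw [← sub_add_cancel (dPow β P) (shift (β, 0) P)] at he
  rcases mem_supp_of_mem_supp_add he with he | he
  · obtain ⟨f, hf, γ, -, hc⟩ := exists_of_mem_supp_dPow_sub β P e he
    exact ⟨f, hf, γ, hc⟩
  · obtain ⟨f, hf, rfl⟩ := exists_of_mem_supp_shift he
    refine ⟨f, hf, 0, ?_⟩
    convert IsContraction.refl _ using 1
    ext <;> simp [add_comm]

theorem exists_of_mem_supp_smul_hAct {c : MvPowerSeries (Fin n) k} {j : ℕ} {P : HDhat k n}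
    {e : (Fin n →₀ ℕ) × (Fin n →₀ ℕ) × ℕ} (h : e ∈ (c • hAct j P).supp) :
    ∃ δ, MvPowerSeries.coeff δ c ≠ 0 ∧ ∃ f ∈ P.supp, e = (δ, 0, j) + f := by
  obtain ⟨δ, hδ, f, hf, rfl⟩ := exists_of_mem_supp_smul h
  obtain ⟨g, hg, rfl⟩ := exists_of_mem_supp_shift hf
  refine ⟨δ, hδ, g, hg, ?_⟩
  ext <;> simp [add_comm]

/-- Every exponent of a product is a contraction of a sum of exponents of the factors. -/
theorem exists_of_mem_supp_mul {P Q : HDhat k n} {e : (Fin n →₀ ℕ) × (Fin n →₀ ℕ) × ℕ}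
    (h : e ∈ (P * Q).supp) :
    ∃ f ∈ P.supp, ∃ g ∈ Q.supp, ∃ γ, IsContraction γ e (f + g) := by
  have h1 : P * Q = ∑ b ∈ P.toFinsupp.support,
      P.seriesCoeff b • hAct b.2 (dPow b.1 Q) := by
    rw [mul_def, lmul, Finsupp.sum, LinearMap.sum_apply]
    rfl
  rw [mem_supp, h1, coeff_sum] at h
  obtain ⟨b, -, hb⟩ := Finset.exists_ne_zero_of_sum_ne_zero h
  obtain ⟨δ, hδ, f, hf, rfl⟩ := exists_of_mem_supp_smul_hAct hb
  obtain ⟨g, hg, γ, hc⟩ := exists_of_mem_supp_dPow hf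
  refine ⟨(δ, b), hδ, g, hg, γ, ?_⟩
  convert hc.add_left (δ, 0, b.2) using 1
  rw [← add_assoc]
  simp

/-- All terms of the product other than the commutative one sit at proper contractions of `f + g`,
which differ from `f + g`. -/
theorem coeff_mono_mul_mono (f g : (Fin n →₀ ℕ) × (Fin n →₀ ℕ) × ℕ) (c d : k) :
    coeff (f + g) (mono f c * mono g d) = c * d := by
  have h1 : mono f c * mono g d = mono (f + g) (c * d) + MvPowerSeries.monomial f.1 c •
      hAct f.2.2 (dPow f.2.1 (mono g d) - shift (f.2.1, 0) (mono g d)) := by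
    rw [mul_def]
    simp only [mono, lmul_term, LinearMap.smul_apply, Module.End.mul_apply, map_sub, shift_term,
      hAct_term, smul_sub, smul_term, MvPowerSeries.monomial_mul_monomial]
    have h2 : g.2 + (f.2.1, 0) + (0, f.2.2) = (f + g).2 := by
      ext <;> simp [add_comm]
    rw [h2, Prod.fst_add, add_sub_cancel]
  rw [h1, coeff_add, coeff_mono, if_pos rfl, add_eq_left]
  by_contra h
  obtain ⟨δ, hδ, e, he, h3⟩ := exists_of_mem_supp_smul_hAct h
  obtain ⟨g', hg', γ, hγ, hc⟩ := exists_of_mem_supp_dPow_sub _ _ _ he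
  obtain rfl := eq_of_mem_supp_mono hg'
  classical
  rw [MvPowerSeries.coeff_monomial] at hδ
  obtain rfl : δ = f.1 := by
    by_contra h4
    exact hδ (if_neg h4)
  refine hγ (IsContraction.eq_zero (e := f + g') ?_)
  convert hc.add_left (f.1, 0, f.2.2) using 1
  rw [← add_assoc]
  congr 1
  simp
end HDhat
-- Properties of the order `≺^h`.
theorem finite_setOf_degree_le (n d : ℕ) : {b : (Fin n →₀ ℕ) × ℕ | b.2 + b.1.degree ≤ d}.Finite := by
  refine Set.Finite.subset ((Finsupp.finite_of_degree_le (σ := Fin n) d).prod (Set.finite_Iic d))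
    fun b hb => ?_
  have hb' : b.2 + b.1.degree ≤ d := hb
  exact ⟨show b.1.degree ≤ d by omega, show b.2 ≤ d by omega⟩

namespace IsAdmissibleOrder

variable {n : ℕ}
  {lt : (Fin n →₀ ℕ) × (Fin n →₀ ℕ) → (Fin n →₀ ℕ) × (Fin n →₀ ℕ) → Prop}

theorem ltHom_irrefl (hlt : IsAdmissibleOrder lt) (e : (Fin n →₀ ℕ) × (Fin n →₀ ℕ) × ℕ) :
    ¬ ltHom lt e e := by
  have := hlt.strictTotal
  rintro (h | h)
  · exact lt_irrefl _ h
  · exact this.irrefl _ h.2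

theorem ltHom_trans (hlt : IsAdmissibleOrder lt) {a b c : (Fin n →₀ ℕ) × (Fin n →₀ ℕ) × ℕ}
    (h1 : ltHom lt a b) (h2 : ltHom lt b c) : ltHom lt a c := by
  have := hlt.strictTotal
  rcases h1 with h1 | h1 <;> rcases h2 with h2 | h2
  · exact Or.inl (h1.trans h2)
  · exact Or.inl (h1.trans_eq h2.1)
  · exact Or.inl (h1.1.trans_lt h2)
  · exact Or.inr ⟨h1.1.trans h2.1, this.trans _ _ _ h1.2 h2.2⟩

theorem ltHom_of_not (hlt : IsAdmissibleOrder lt) {e f : (Fin n →₀ ℕ) × (Fin n →₀ ℕ) × ℕ}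
    (h : ¬ ltHom lt e f) : f = e ∨ ltHom lt f e := by
  have hto := hlt.strictTotal
  rcases lt_trichotomy (f.2.2 + f.2.1.degree) (e.2.2 + e.2.1.degree) with h' | h' | h'
  · exact Or.inr (Or.inl h')
  · by_cases h1 : lt (f.1, f.2.1) (e.1, e.2.1)
    · exact Or.inr (Or.inr ⟨h', h1⟩)
    · have h4 := hto.trichotomous _ _ h1 fun h3 => h (Or.inr ⟨h'.symm, h3⟩)
      obtain ⟨α, β, j⟩ := e
      obtain ⟨α', β', j'⟩ := f
      simp only [Prod.mk.injEq] at h4 h'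
      obtain ⟨rfl, rfl⟩ := h4
      exact Or.inl (by rw [add_right_cancel h'])
  · exact absurd (Or.inl h') h

theorem ltHom_add_left (hlt : IsAdmissibleOrder lt) {e f : (Fin n →₀ ℕ) × (Fin n →₀ ℕ) × ℕ}
    (g : (Fin n →₀ ℕ) × (Fin n →₀ ℕ) × ℕ) (h : ltHom lt e f) : ltHom lt (g + e) (g + f) := by
  rcases h with h | h
  · left
    simp only [Prod.fst_add, Prod.snd_add, map_add]
    omega
  · right
    simp only [Prod.fst_add, Prod.snd_add, map_add]
    exact ⟨by omega, hlt.add_left _ _ (g.1, g.2.1) h.2⟩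

theorem zero_lt_diag (hlt : IsAdmissibleOrder lt) (γ : Fin n →₀ ℕ) : γ = 0 ∨ lt 0 (γ, γ) := by
  have hto := hlt.strictTotal
  have hadd : ∀ β γ : Fin n →₀ ℕ, (β = 0 ∨ lt 0 (β, β)) → (γ = 0 ∨ lt 0 (γ, γ)) →
      (β + γ = 0 ∨ lt 0 (β + γ, β + γ)) := by
    rintro β γ (rfl | hβ) hγ
    · simpa using hγ
    · right
      rcases hγ with rfl | hγ
      · simpa using hβ
      · have h := hlt.add_left _ _ (β, β) hγ
        rw [add_zero] at h
        exact hto.trans _ _ _ hβ h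
  induction γ using Finsupp.induction_linear with
  | zero => exact Or.inl rfl
  | add β γ hβ hγ => exact hadd β γ hβ hγ
  | single i m =>
    induction m with
    | zero => simp
    | succ m ih =>
      rw [Finsupp.single_add]
      exact hadd _ _ ih (Or.inr (hlt.one_lt_x_xi i))

/-- The degree is unchanged, so `≺` decides, and `1 ≺ x^γ ξ^γ` follows from `1 ≺ x_i ξ_i`. This is
what makes the noncommutative correction terms harmless. -/
theorem ltHom_of_isContraction (hlt : IsAdmissibleOrder lt) {γ : Fin n →₀ ℕ}
    {e f : (Fin n →₀ ℕ) × (Fin n →₀ ℕ) × ℕ} (hγ : γ ≠ 0) (h : HDhat.IsContraction γ e f) :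
    ltHom lt e f := by
  refine Or.inr ⟨h.degree_eq, ?_⟩
  have h1 := hlt.add_left _ _ (e.1, e.2.1) ((hlt.zero_lt_diag γ).resolve_left hγ)
  rwa [add_zero, Prod.mk_add_mk, ← h.1, ← h.2.1] at h1

theorem x_lt_one_of_ne_zero (hlt : IsAdmissibleOrder lt) (δ α β : Fin n →₀ ℕ) :
    δ = 0 ∨ lt (δ + α, β) (α, β) := by
  have hto := hlt.strictTotal
  induction δ using Finsupp.induction_linear generalizing α with
  | zero => exact Or.inl rfl
  | add δ ε hδ hε =>
    rcases hε α with rfl | h'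
    · simpa using hδ α
    · right
      rw [add_assoc]
      rcases hδ (ε + α) with rfl | h
      · simpa using h'
      · exact hto.trans _ _ _ h h'
  | single i m =>
    induction m with
    | zero => simp
    | succ m ih =>
      right
      have h := hlt.add_left _ _ (Finsupp.single i m + α, β) (hlt.x_lt_one i)
      rw [add_zero, Prod.mk_add_mk, add_zero, add_right_comm, ← Finsupp.single_add] at h
      rcases ih with h0 | h1
      · rwa [h0, zero_add] at h
      · exact hto.trans _ _ _ h h1

/-- In bounded degree there is no infinite `≺^h`-increasing sequence. -/
theorem wellFoundedOn_degree_le (hlt : IsAdmissibleOrder lt) (d : ℕ) :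
    {e : (Fin n →₀ ℕ) × (Fin n →₀ ℕ) × ℕ | e.2.2 + e.2.1.degree ≤ d}.WellFoundedOn
      (fun a b => ltHom lt b a) := by
  have hto := hlt.strictTotal
  have hso : IsStrictOrder _ (fun a b => ltHom lt b a) :=
    { irrefl := hlt.ltHom_irrefl
      trans := fun a b c h1 h2 => hlt.ltHom_trans h2 h1 }
  refine Set.WellFoundedOn.subset
    (t := ⋃ b ∈ (finite_setOf_degree_le n d).toFinset,
      {f : (Fin n →₀ ℕ) × (Fin n →₀ ℕ) × ℕ | f.2 = b})
    ((Finset.wellFoundedOn_bUnion _).2 fun b _ => ?_)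
    fun f hf => Set.mem_iUnion₂.2 ⟨f.2, (finite_setOf_degree_le n d).mem_toFinset.2 hf, rfl⟩
  rw [Set.wellFoundedOn_iff_no_descending_seq]
  intro g hg
  -- With `(β, j)` fixed, Dickson's lemma gives `p < q` such that the `x`-exponent at `q` is a
  -- multiple of that at `p`. As `x^δ ≼ 1`, the term at `q` is not larger, so the sequence does not
  -- increase.
  obtain ⟨p, q, hpq, hle⟩ := wellQuasiOrdered_le (α := Fin n →₀ ℕ) fun m => (g m).1
  have h1 : ltHom lt (g p) (g q) := g.map_rel_iff.2 hpq
  have hp : (g p).2 = b := hg p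
  have hq : (g q).2 = b := hg q
  rw [ltHom, hp, hq] at h1
  have h2 := (h1.resolve_left (lt_irrefl _)).2
  obtain ⟨δ, hδ⟩ := exists_add_of_le hle
  rw [show (g q).1 = δ + (g p).1 from hδ.trans (add_comm _ _)] at h2
  rcases hlt.x_lt_one_of_ne_zero δ (g p).1 b.1 with h0 | h0
  · rw [h0, zero_add] at h2
    exact hto.irrefl _ h2
  · exact hto.irrefl _ (hto.trans _ _ _ h2 h0)

end IsAdmissibleOrder

/-! ### Leading exponents and leading coefficients of products. -/

namespace HDhat

variable {k : Type*} [Field k] {n r : ℕ}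
  {lt : (Fin n →₀ ℕ) × (Fin n →₀ ℕ) → (Fin n →₀ ℕ) × (Fin n →₀ ℕ) → Prop}

theorem le_leadExp (hlt : IsAdmissibleOrder lt) {P : HDhat k n}
    {e : (Fin n →₀ ℕ) × (Fin n →₀ ℕ) × ℕ} (h : e ∈ P.supp) :
    e = P.leadExp lt ∨ ltHom lt e (P.leadExp lt) := by
  have hP : P ≠ 0 := by
    rintro rfl
    exact h (coeff_zero e)
  by_cases he : e = P.leadExp lt
  · exact Or.inl he
  · exact Or.inr ((isLeadExp_leadExp hlt hP).2 e h he)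

theorem coeff_leadExp_ne_zero (hlt : IsAdmissibleOrder lt) {P : HDhat k n} (hP : P ≠ 0) :
    coeff (P.leadExp lt) P ≠ 0 :=
  (isLeadExp_leadExp hlt hP).1

theorem exists_of_mem_supp_mul_leadExp (hlt : IsAdmissibleOrder lt) {Q D : HDhat k n}
    {e : (Fin n →₀ ℕ) × (Fin n →₀ ℕ) × ℕ} (h : e ∈ (Q * D).supp) :
    ∃ f ∈ Q.supp, e = f + D.leadExp lt ∨ ltHom lt e (f + D.leadExp lt) := by
  obtain ⟨f, hf, g, hg, γ, hc⟩ := exists_of_mem_supp_mul h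
  refine ⟨f, hf, ?_⟩
  have h1 : e = f + g ∨ ltHom lt e (f + g) := by
    by_cases hγ : γ = 0
    · subst hγ
      exact Or.inl hc.eq_of_zero
    · exact Or.inr (hlt.ltHom_of_isContraction hγ hc)
  rcases le_leadExp hlt hg with h2 | h2
  · rwa [← h2]
  · have h3 := hlt.ltHom_add_left f h2
    rcases h1 with rfl | h1
    · exact Or.inr h3
    · exact Or.inr (hlt.ltHom_trans h1 h3)

theorem coeff_mul_eq_zero (hlt : IsAdmissibleOrder lt) {Q D : HDhat k n}
    {e : (Fin n →₀ ℕ) × (Fin n →₀ ℕ) × ℕ} (h : ∀ f ∈ Q.supp, ltHom lt (f + D.leadExp lt) e) :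
    coeff e (Q * D) = 0 := by
  by_contra h0
  obtain ⟨f, hf, h1⟩ := exists_of_mem_supp_mul_leadExp hlt h0
  have h2 := h f hf
  rcases h1 with h1 | h1
  · rw [← h1] at h2
    exact hlt.ltHom_irrefl _ h2
  · exact hlt.ltHom_irrefl _ (hlt.ltHom_trans h1 h2)

/-- The leading coefficient of a product. -/
theorem coeff_mul_leadExp (hlt : IsAdmissibleOrder lt) {Q D : HDhat k n}
    {f : (Fin n →₀ ℕ) × (Fin n →₀ ℕ) × ℕ}
    (h : ∀ g ∈ Q.supp, g ≠ f → ltHom lt (g + D.leadExp lt) (f + D.leadExp lt)) :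
    coeff (f + D.leadExp lt) (Q * D) = coeff f Q * coeff (D.leadExp lt) D := by
  set e := D.leadExp lt with he
  -- Both factors are split into the chosen monomial and the rest; only the product of the two
  -- monomials reaches the exponent `f + e`.
  have h1 : Q * D = (Q - mono f (coeff f Q)) * D +
      (mono f (coeff f Q) * mono e (coeff e D) +
        mono f (coeff f Q) * (D - mono e (coeff e D))) := by
    noncomm_ring
  have h2 : coeff (f + e) ((Q - mono f (coeff f Q)) * D) = 0 := by
    refine coeff_mul_eq_zero hlt fun g hg => ?_
    obtain ⟨hg1, hg2⟩ := mem_supp_sub_mono hg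
    exact h g hg1 hg2
  have h3 : coeff (f + e) (mono f (coeff f Q) * (D - mono e (coeff e D))) = 0 := by
    by_contra h0
    obtain ⟨f', hf, g, hg, γ, hc⟩ := exists_of_mem_supp_mul h0
    obtain rfl := eq_of_mem_supp_mono hf
    obtain ⟨hg1, hg2⟩ := mem_supp_sub_mono hg
    have h4 := hlt.ltHom_add_left f' ((le_leadExp hlt hg1).resolve_left hg2)
    rw [← he] at h4
    by_cases hγ : γ = 0
    · subst hγ
      rw [hc.eq_of_zero] at h4
      exact hlt.ltHom_irrefl _ h4
    · exact hlt.ltHom_irrefl _ (hlt.ltHom_trans h4 (hlt.ltHom_of_isContraction hγ hc))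
  rw [h1, coeff_add, coeff_add, h2, h3, coeff_mono_mul_mono, zero_add, add_zero]

/-! ### The top coefficient of a division, cell by cell. -/

theorem divisionCell_disjoint {e : Fin r → (Fin n →₀ ℕ) × (Fin n →₀ ℕ) × ℕ} {i j : Fin r}
    {f : (Fin n →₀ ℕ) × (Fin n →₀ ℕ) × ℕ} (hi : f ∈ divisionCell e i)
    (hj : f ∈ divisionCell e j) : i = j := by
  rcases lt_trichotomy i j with h | h | h
  · exact absurd hi.1 (hj.2 i h)
  · exact h
  · exact absurd hj.1 (hi.2 j h)

/-- The element of the support of `∑ Q_j D_j + R` that corresponds to an exponent of a quotient,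
if the other exponents of quotients and remainder are smaller. -/
theorem coeff_sum_add_of_mem_divisionCell (hlt : IsAdmissibleOrder lt) {D Q : Fin r → HDhat k n}
    {R : HDhat k n} {j : Fin r} {f : (Fin n →₀ ℕ) × (Fin n →₀ ℕ) × ℕ}
    (hQ : ∀ i, ∀ g ∈ (Q i).supp,
      g + (D i).leadExp lt ∈ divisionCell (fun i => (D i).leadExp lt) i)
    (hR : R.supp ⊆ remainderCell (fun i => (D i).leadExp lt))
    (hf : f + (D j).leadExp lt ∈ divisionCell (fun i => (D i).leadExp lt) j)
    (h : ∀ i, ∀ g ∈ (Q i).supp, g + (D i).leadExp lt ≠ f + (D j).leadExp lt →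
      ltHom lt (g + (D i).leadExp lt) (f + (D j).leadExp lt)) :
    coeff (f + (D j).leadExp lt) ((∑ i, Q i * D i) + R) =
      coeff f (Q j) * coeff ((D j).leadExp lt) (D j) := by
  have h1 : coeff (f + (D j).leadExp lt) R = 0 := by
    by_contra h0
    exact hR h0 j hf
  rw [coeff_add, coeff_sum, h1, add_zero, Finset.sum_eq_single j, coeff_mul_leadExp hlt]
  · exact fun g hg hne => h j g hg fun h0 => hne (add_right_cancel h0)
  -- A shifted exponent of `Q i`, `i ≠ j`, equal to this one would lie in two disjoint cells, so all
  -- of them are strictly smaller.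
  · refine fun i _ hij => coeff_mul_eq_zero hlt fun g hg => h i g hg fun h0 => hij ?_
    have h2 := hQ i g hg
    rw [h0] at h2
    exact divisionCell_disjoint h2 hf
  · simp

/-- Shifted quotient exponents lie in division cells, so none equals `e`; by assumption they are
then strictly below `e`, and the products contribute nothing there. -/
theorem coeff_sum_add_of_mem_remainderCell (hlt : IsAdmissibleOrder lt) {D Q : Fin r → HDhat k n}
    {R : HDhat k n} {e : (Fin n →₀ ℕ) × (Fin n →₀ ℕ) × ℕ}
    (hQ : ∀ i, ∀ g ∈ (Q i).supp,
      g + (D i).leadExp lt ∈ divisionCell (fun i => (D i).leadExp lt) i)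
    (he : e ∈ remainderCell (fun i => (D i).leadExp lt))
    (h : ∀ i, ∀ g ∈ (Q i).supp, g + (D i).leadExp lt ≠ e → ltHom lt (g + (D i).leadExp lt) e) :
    coeff e ((∑ i, Q i * D i) + R) = coeff e R := by
  rw [coeff_add, coeff_sum, Finset.sum_eq_zero, zero_add]
  refine fun i _ => coeff_mul_eq_zero hlt fun g hg => h i g hg ?_
  rintro rfl
  exact he i (hQ i g hg)

end HDhat
-- Triangular linear systems.
/-- A triangular system of linear equations over a well-founded index set has a solution. -/
theorem exists_solution_of_triangular {k E : Type*} [Field k] {S : Set E} {rel : E → E → Prop}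
    (hwf : S.WellFoundedOn rel) (T : (E → k) → E → k) (hadd : ∀ u v, T (u + v) = T u + T v)
    (a : E → k) (ha : ∀ e, a e ≠ 0)
    (hT : ∀ u, ∀ e ∈ S, (∀ f ∈ S, rel f e → u f = 0) → T u e = a e * u e) (p : E → k) :
    ∃ u, ∀ e ∈ S, T u e = p e := by
  classical
  have hwf' : WellFounded (fun a b : S => rel a b) := hwf
  -- The equation at `e` is solved for `u e`, with the earlier values inserted and all other
  -- unknowns set to `0`.
  let u₀ : S → k := WellFounded.fix (C := fun _ => k) hwf' fun e ih =>
    (p e - T (fun f => if h : ∃ hf : f ∈ S, rel f e then ih ⟨f, h.1⟩ h.2 else 0) e) / a e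
  let u : E → k := fun f => if h : f ∈ S then u₀ ⟨f, h⟩ else 0
  refine ⟨u, fun e he => ?_⟩
  let w : E → k := fun f => if f ∈ S ∧ rel f e then u f else 0
  have hu : u e = (p e - T w e) / a e := by
    have h1 : u e = u₀ ⟨e, he⟩ := dif_pos he
    rw [h1]
    simp only [u₀]
    rw [WellFounded.fix_eq]
    congr 4
    ext f
    by_cases hf : f ∈ S ∧ rel f e
    · rw [dif_pos ⟨hf.1, hf.2⟩]
      simp only [w, u]
      rw [if_pos hf, dif_pos hf.1]
    · rw [dif_neg fun h => hf ⟨h.1, h.2⟩]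
      simp only [w]
      rw [if_neg hf]
  have hirr : ¬ rel e e := fun h => by
    have := hwf'.irrefl
    exact this.irrefl (⟨e, he⟩ : S) h
  have hw : w e = 0 := if_neg fun h => hirr h.2
  -- Subtracting the part `w` of `u` that precedes `e` makes the diagonal rule applicable;
  -- additivity then restores `T u e`.
  have h1 := hT (u - w) e he fun f hf hfe => by
    simp only [Pi.sub_apply, w]
    rw [if_pos ⟨hf, hfe⟩, sub_self]
  have h2 := congrFun (hadd (u - w) w) e
  rw [sub_add_cancel, Pi.add_apply, h1, Pi.sub_apply, hw, hu] at h2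
  rw [h2]
  have := ha e
  field_simp
  ring

/-! ### Existence of the division. -/

namespace HDhat

variable {k : Type*} [Field k] {n r : ℕ}
  {lt : (Fin n →₀ ℕ) × (Fin n →₀ ℕ) → (Fin n →₀ ℕ) × (Fin n →₀ ℕ) → Prop}

/-- The operator with coefficients `u`, cut off in degrees above `d`. -/
noncomputable def ofCoeffs (d : ℕ) (u : (Fin n →₀ ℕ) × (Fin n →₀ ℕ) × ℕ → k) : HDhat k n :=
  (Finsupp.onFinset (finite_setOf_degree_le n d).toFinset
    (fun b => (fun α => if b.2 + b.1.degree ≤ d then u (α, b) else 0 : MvPowerSeries (Fin n) k))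
    (fun b hb => by
      rw [Set.Finite.mem_toFinset]
      by_contra h
      exact hb (funext fun α => if_neg h)) :)

theorem coeff_ofCoeffs (d : ℕ) (u : (Fin n →₀ ℕ) × (Fin n →₀ ℕ) × ℕ → k)
    (e : (Fin n →₀ ℕ) × (Fin n →₀ ℕ) × ℕ) :
    coeff e (ofCoeffs d u) = if e.2.2 + e.2.1.degree ≤ d then u e else 0 := rfl

theorem of_mem_supp_ofCoeffs {d : ℕ} {u : (Fin n →₀ ℕ) × (Fin n →₀ ℕ) × ℕ → k}
    {e : (Fin n →₀ ℕ) × (Fin n →₀ ℕ) × ℕ} (h : e ∈ (ofCoeffs d u).supp) :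
    e.2.2 + e.2.1.degree ≤ d ∧ u e ≠ 0 := by
  rw [mem_supp, coeff_ofCoeffs] at h
  by_cases h1 : e.2.2 + e.2.1.degree ≤ d
  · rw [if_pos h1] at h
    exact ⟨h1, h⟩
  · exact absurd (if_neg h1) h

theorem ofCoeffs_add (d : ℕ) (u v : (Fin n →₀ ℕ) × (Fin n →₀ ℕ) × ℕ → k) :
    ofCoeffs d (u + v) = ofCoeffs d u + ofCoeffs d v := by
  refine coeff_ext fun e => ?_
  simp only [coeff_add, coeff_ofCoeffs, Pi.add_apply]
  split_ifs <;> simp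

theorem degree_le_deg {P : HDhat k n} {e : (Fin n →₀ ℕ) × (Fin n →₀ ℕ) × ℕ} (h : e ∈ P.supp) :
    e.2.2 + e.2.1.degree ≤ P.deg := by
  have h1 : e.2 ∈ P.toFinsupp.support := by
    refine Finsupp.mem_support_iff.2 fun h0 => h ?_
    change MvPowerSeries.coeff e.1 (P.toFinsupp e.2) = 0
    rw [h0, map_zero]
  rw [add_comm]
  exact Finset.le_sup (f := fun b : (Fin n →₀ ℕ) × ℕ => b.1.degree + b.2) h1

theorem isHomogeneous_of_degree_eq {P : HDhat k n} (h : ∀ e ∈ P.supp, ∀ f ∈ P.supp,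
    e.2.2 + e.2.1.degree = f.2.2 + f.2.1.degree) : P.IsHomogeneous := by
  intro e he
  refine le_antisymm ((add_comm _ _).trans_le (degree_le_deg he)) (Finset.sup_le fun b hb => ?_)
  obtain ⟨α, hα⟩ : ∃ α, MvPowerSeries.coeff α (P.toFinsupp b) ≠ 0 := by
    by_contra! h0
    exact Finsupp.mem_support_iff.1 hb (MvPowerSeries.ext h0)
  have := h (α, b) hα e he
  simp only at this
  omega

theorem degree_le_of_eq_or_ltHom {e f : (Fin n →₀ ℕ) × (Fin n →₀ ℕ) × ℕ}
    (h : e = f ∨ ltHom lt e f) :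
    e.2.2 + e.2.1.degree ≤ f.2.2 + f.2.1.degree := by
  rcases h with rfl | h | h
  · exact le_rfl
  · exact h.le
  · exact h.1.le

theorem mem_remainderCell_or_divisionCell (a : Fin r → (Fin n →₀ ℕ) × (Fin n →₀ ℕ) × ℕ)
    (e : (Fin n →₀ ℕ) × (Fin n →₀ ℕ) × ℕ) :
    e ∈ remainderCell a ∨ ∃ j, ∃ f, f + a j ∈ divisionCell a j ∧ f + a j = e := by
  by_cases h : e ∈ remainderCell a
  · exact Or.inl h
  · obtain ⟨j, hj⟩ : ∃ j, e ∈ divisionCell a j := by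
      simpa only [remainderCell, Set.mem_ofPred_eq, not_forall, not_not] using h
    obtain ⟨g, hg⟩ := hj.1
    refine Or.inr ⟨j, g, ?_, ?_⟩ <;> rw [add_comm, ← hg]
    exact hj

/-- The triangular system is indexed by the exponents of degree at most `deg P`, with the relation
reversing `≺^h` so that the recursion starts from the largest exponents. -/
theorem exists_isDivision (hlt : IsAdmissibleOrder lt) (D : Fin r → HDhat k n)
    (hD : ∀ j, D j ≠ 0) (P : HDhat k n) :
    ∃ (Q : Fin r → HDhat k n) (R : HDhat k n), IsDivision lt D P Q R := by
  classical
  set d := P.deg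
  set a : Fin r → (Fin n →₀ ℕ) × (Fin n →₀ ℕ) × ℕ := fun i => (D i).leadExp lt
  -- The bound is imposed on `f + a j` and not only on `f`, so that every value of `u` used belongs
  -- to the index set of the system.
  let q : Fin r → ((Fin n →₀ ℕ) × (Fin n →₀ ℕ) × ℕ → k) → HDhat k n := fun j u => ofCoeffs d
    fun f => if f + a j ∈ divisionCell a j ∧
      (f + a j).2.2 + (f + a j).2.1.degree ≤ d then u (f + a j) else 0
  let R : ((Fin n →₀ ℕ) × (Fin n →₀ ℕ) × ℕ → k) → HDhat k n := fun u => ofCoeffs d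
    fun f => if f ∈ remainderCell a then u f else 0
  have hq : ∀ j u f, f ∈ (q j u).supp → f + a j ∈ divisionCell a j ∧
      (f + a j).2.2 + (f + a j).2.1.degree ≤ d ∧ u (f + a j) ≠ 0 := by
    intro j u f hf
    have h1 := (of_mem_supp_ofCoeffs hf).2
    rw [ite_ne_right_iff] at h1
    exact ⟨h1.1.1, h1.1.2, h1.2⟩
  have hR : ∀ u f, f ∈ (R u).supp → f ∈ remainderCell a ∧
      f.2.2 + f.2.1.degree ≤ d ∧ u f ≠ 0 := by
    intro u f hf
    have h1 := of_mem_supp_ofCoeffs hf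
    rw [ite_ne_right_iff] at h1
    exact ⟨h1.2.1, h1.1, h1.2.2⟩
  have hqadd : ∀ j u v, q j (u + v) = q j u + q j v := by
    intro j u v
    simp only [q]
    rw [← ofCoeffs_add]
    congr 1
    ext f
    simp only [Pi.add_apply]
    split_ifs <;> simp
  have hRadd : ∀ u v, R (u + v) = R u + R v := by
    intro u v
    simp only [R]
    rw [← ofCoeffs_add]
    congr 1
    ext f
    simp only [Pi.add_apply]
    split_ifs <;> simp
  -- The diagonal entries: on the remainder cell the value is `1`, because `R` enters the equation
  -- with coefficient `1`.
  let c : (Fin n →₀ ℕ) × (Fin n →₀ ℕ) × ℕ → k := fun e =>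
    if h : ∃ j, e ∈ divisionCell a j then coeff (a h.choose) (D h.choose) else 1
  have hcj : ∀ j e, e ∈ divisionCell a j → c e = coeff (a j) (D j) := by
    intro j e he
    have h : ∃ j, e ∈ divisionCell a j := ⟨j, he⟩
    have h1 : h.choose = j := divisionCell_disjoint h.choose_spec he
    simp only [c]
    rw [dif_pos h, h1]
  have hc0 : ∀ e, c e ≠ 0 := by
    intro e
    by_cases h : ∃ j, e ∈ divisionCell a j
    · obtain ⟨j, hj⟩ := h
      rw [hcj j e hj]
      exact coeff_leadExp_ne_zero hlt (hD j)
    · simp only [c]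
      rw [dif_neg h]
      exact one_ne_zero
  have hTadd : ∀ u v : (Fin n →₀ ℕ) × (Fin n →₀ ℕ) × ℕ → k,
      (fun e => coeff e ((∑ j, q j (u + v) * D j) + R (u + v))) =
        (fun e => coeff e ((∑ j, q j u * D j) + R u)) +
          fun e => coeff e ((∑ j, q j v * D j) + R v) := by
    intro u v
    ext e
    rw [Pi.add_apply, ← coeff_add]
    congr 1
    simp only [hqadd, hRadd, add_mul, Finset.sum_add_distrib]
    abel
  have hdiag : ∀ u, ∀ e ∈ {e : (Fin n →₀ ℕ) × (Fin n →₀ ℕ) × ℕ | e.2.2 + e.2.1.degree ≤ d},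
      (∀ f ∈ {e : (Fin n →₀ ℕ) × (Fin n →₀ ℕ) × ℕ | e.2.2 + e.2.1.degree ≤ d},
        ltHom lt e f → u f = 0) →
      coeff e ((∑ j, q j u * D j) + R u) = c e * u e := by
    intro u e he hz
    -- Since `u` vanishes above `e`, every other exponent that occurs is below `e`, as the
    -- top-coefficient lemmas require.
    have hlow : ∀ f, f.2.2 + f.2.1.degree ≤ d → u f ≠ 0 → f ≠ e → ltHom lt f e := by
      intro f hf huf hfe
      by_contra h0
      rcases hlt.ltHom_of_not h0 with h1 | h1
      · exact hfe h1.symm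
      · exact huf (hz f hf h1)
    rcases mem_remainderCell_or_divisionCell a e with h | ⟨j, f, hf, rfl⟩
    · have h1 : c e = 1 := dif_neg fun ⟨j, hj⟩ => h j hj
      rw [coeff_sum_add_of_mem_remainderCell hlt (fun j f hf => (hq j u f hf).1) h
        fun i g hg hne => hlow _ (hq i u g hg).2.1 (hq i u g hg).2.2 hne, h1, one_mul]
      simp only [R]
      rw [coeff_ofCoeffs, if_pos (show e.2.2 + e.2.1.degree ≤ d from he), if_pos h]
    · rw [hcj j _ hf]
      have he' : (f + a j).2.2 + (f + a j).2.1.degree ≤ d := he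
      have h2 : f.2.2 + f.2.1.degree ≤ d := by
        refine le_trans ?_ he'
        simp only [Prod.snd_add, Prod.fst_add, map_add]
        omega
      rw [coeff_sum_add_of_mem_divisionCell hlt (fun j f hf => (hq j u f hf).1)
        (fun f hf => (hR u f hf).1) hf
        fun i g hg hne => hlow _ (hq i u g hg).2.1 (hq i u g hg).2.2 hne, mul_comm]
      congr 1
      simp only [q]
      rw [coeff_ofCoeffs, if_pos h2, if_pos ⟨hf, he'⟩]
  obtain ⟨u, hu⟩ := exists_solution_of_triangular (hlt.wellFoundedOn_degree_le d)
    (fun u e => coeff e ((∑ j, q j u * D j) + R u)) hTadd c hc0 hdiag (fun e => coeff e P)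
  refine ⟨fun j => q j u, R u, ?_, fun j _ f hf => (hq j u f hf).1, fun _ f hf => (hR u f hf).1⟩
  refine coeff_ext fun e => ?_
  -- The system covers degrees up to `d`; beyond that both sides vanish, since products do not
  -- exceed the degree of the shifted quotient exponents.
  by_cases he : e.2.2 + e.2.1.degree ≤ d
  · exact (hu e he).symm
  · have h1 : coeff e P = 0 := by
      by_contra h0
      exact he (degree_le_deg h0)
    have h2 : coeff e (R u) = 0 := by
      by_contra h0
      exact he (hR u e h0).2.1
    rw [h1, coeff_add, h2, add_zero, coeff_sum, Finset.sum_eq_zero]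
    intro j _
    by_contra h0
    obtain ⟨f, hf, h3⟩ := exists_of_mem_supp_mul_leadExp hlt h0
    exact he ((degree_le_of_eq_or_ltHom h3).trans (hq j u f hf).2.1)

/-! ### Uniqueness of the division. -/

theorem exponent_cells_of_isDivision {D Q : Fin r → HDhat k n} {P R : HDhat k n}
    (h : IsDivision lt D P Q R) :
    (∀ i, ∀ g ∈ (Q i).supp, g + (D i).leadExp lt ∈ divisionCell (fun i => (D i).leadExp lt) i) ∧
      R.supp ⊆ remainderCell (fun i => (D i).leadExp lt) := by
  refine ⟨fun i g hg => h.quotient_supp i ?_ g hg, fun g hg => h.remainder_supp ?_ hg⟩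
  · intro h0
    rw [h0] at hg
    exact hg (coeff_zero g)
  · rintro rfl
    exact hg (coeff_zero g)

theorem mem_supp_of_mem_supp_sub {P Q : HDhat k n} {e : (Fin n →₀ ℕ) × (Fin n →₀ ℕ) × ℕ}
    (h : e ∈ (P - Q).supp) : e ∈ P.supp ∨ e ∈ Q.supp := by
  by_contra! h'
  simp only [mem_supp, not_not] at h'
  exact h (by rw [coeff_sub, h'.1, h'.2, sub_zero])

theorem isDivision_sub {D Q Q' : Fin r → HDhat k n} {P P' R R' : HDhat k n}
    (h : IsDivision lt D P Q R) (h' : IsDivision lt D P' Q' R') :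
    IsDivision lt D (P - P') (fun j => Q j - Q' j) (R - R') := by
  refine ⟨?_, fun j _ f hf => ?_, fun _ f hf => ?_⟩
  · rw [h.eq_sum_add, h'.eq_sum_add]
    simp only [sub_mul, Finset.sum_sub_distrib]
    abel
  · rcases mem_supp_of_mem_supp_sub hf with hf | hf
    · exact (exponent_cells_of_isDivision h).1 j f hf
    · exact (exponent_cells_of_isDivision h').1 j f hf
  · rcases mem_supp_of_mem_supp_sub hf with hf | hf
    · exact (exponent_cells_of_isDivision h).2 hf
    · exact (exponent_cells_of_isDivision h').2 hf

/-- Otherwise the shifted quotient exponents and the exponents of `R` have a `≺^h`-maximum. There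
the sum has a nonzero coefficient: that of `R`, or one of `Q j` times the leading coefficient of `D
j`. -/
theorem eq_zero_of_isDivision_zero (hlt : IsAdmissibleOrder lt) {D Q : Fin r → HDhat k n}
    {R : HDhat k n} (hD : ∀ j, D j ≠ 0) (h : IsDivision lt D 0 Q R) :
    (∀ j, Q j = 0) ∧ R = 0 := by
  obtain ⟨hQ, hR⟩ := exponent_cells_of_isDivision h
  set S : Set ((Fin n →₀ ℕ) × (Fin n →₀ ℕ) × ℕ) :=
    {e | (∃ j, ∃ f ∈ (Q j).supp, f + (D j).leadExp lt = e) ∨ e ∈ R.supp} with hS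
  -- A crude bound suffices: it only places `S` in bounded degree, where a maximum exists.
  have hbound : S ⊆ {e | e.2.2 + e.2.1.degree ≤ R.deg + ∑ j, ((Q j).deg +
      (((D j).leadExp lt).2.2 + ((D j).leadExp lt).2.1.degree))} := by
    rintro e (⟨j, f, hf, rfl⟩ | he)
    · have h1 := degree_le_deg hf
      have h2 := Finset.single_le_sum (f := fun j => (Q j).deg +
        (((D j).leadExp lt).2.2 + ((D j).leadExp lt).2.1.degree)) (fun _ _ => Nat.zero_le _)
        (Finset.mem_univ j)
      simp only [Set.mem_ofPred_eq, Prod.snd_add, Prod.fst_add, map_add] at h2 ⊢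
      omega
    · exact (degree_le_deg he).trans (Nat.le_add_right _ _)
  have hempty : S = ∅ := by
    by_contra hne
    obtain ⟨⟨e, he⟩, -, hmin⟩ := ((hlt.wellFoundedOn_degree_le _).subset hbound).has_min Set.univ
      (Set.nonempty_iff_univ_nonempty.1 (Set.nonempty_iff_ne_empty.2 hne).to_subtype)
    have hmax : ∀ f ∈ S, f ≠ e → ltHom lt f e := fun f hf hfe => by
      rcases hlt.ltHom_of_not (hmin ⟨f, hf⟩ trivial) with h1 | h1
      · exact absurd h1 hfe
      · exact h1
    have h0 : coeff e ((∑ j, Q j * D j) + R) = 0 := by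
      rw [← h.eq_sum_add, coeff_zero]
    rcases he with ⟨j, f, hf, rfl⟩ | he
    · rw [coeff_sum_add_of_mem_divisionCell hlt hQ hR (hQ j f hf)
        fun i g hg => hmax _ (Or.inl ⟨i, g, hg, rfl⟩)] at h0
      exact mul_ne_zero hf (coeff_leadExp_ne_zero hlt (hD j)) h0
    · rw [coeff_sum_add_of_mem_remainderCell hlt hQ (hR he)
        fun i g hg => hmax _ (Or.inl ⟨i, g, hg, rfl⟩)] at h0
      exact he h0
  constructor
  · refine fun j => eq_zero_of_supp fun f hf => ?_
    have : f + (D j).leadExp lt ∈ S := Or.inl ⟨j, f, hf, rfl⟩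
    rw [hempty] at this
    exact this
  · refine eq_zero_of_supp fun f hf => ?_
    have : f ∈ S := Or.inr hf
    rw [hempty] at this
    exact this

theorem isDivision_unique (hlt : IsAdmissibleOrder lt) {D Q Q' : Fin r → HDhat k n}
    {P R R' : HDhat k n} (hD : ∀ j, D j ≠ 0) (h : IsDivision lt D P Q R)
    (h' : IsDivision lt D P Q' R') : Q = Q' ∧ R = R' := by
  have h1 := isDivision_sub h h'
  rw [sub_self] at h1
  obtain ⟨h2, h3⟩ := eq_zero_of_isDivision_zero hlt hD h1
  exact ⟨funext fun j => sub_eq_zero.1 (h2 j), sub_eq_zero.1 h3⟩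

/-! ### Homogeneity. -/

open scoped Classical in
/-- The sum of the homogeneous components of `P` whose degree satisfies `p`. -/
noncomputable def degreeFilter (p : ℕ → Prop) (P : HDhat k n) : HDhat k n :=
  (P.toFinsupp.filter fun b => p (b.2 + b.1.degree) :)

open scoped Classical in
theorem coeff_degreeFilter (p : ℕ → Prop) (P : HDhat k n)
    (e : (Fin n →₀ ℕ) × (Fin n →₀ ℕ) × ℕ) :
    coeff e (degreeFilter p P) = if p (e.2.2 + e.2.1.degree) then coeff e P else 0 := by
  change MvPowerSeries.coeff e.1 ((P.toFinsupp.filter fun b => p (b.2 + b.1.degree)) e.2) = _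
  rw [Finsupp.filter_apply]
  split_ifs
  · rfl
  · exact map_zero _

theorem of_mem_supp_degreeFilter {p : ℕ → Prop} {P : HDhat k n}
    {e : (Fin n →₀ ℕ) × (Fin n →₀ ℕ) × ℕ} (h : e ∈ (degreeFilter p P).supp) :
    e ∈ P.supp ∧ p (e.2.2 + e.2.1.degree) := by
  classical
  rw [mem_supp, coeff_degreeFilter, ite_ne_right_iff] at h
  exact h.symm

theorem of_mem_supp_sub_degreeFilter {p : ℕ → Prop} {P : HDhat k n}
    {e : (Fin n →₀ ℕ) × (Fin n →₀ ℕ) × ℕ} (h : e ∈ (P - degreeFilter p P).supp) :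
    ¬ p (e.2.2 + e.2.1.degree) := by
  classical
  intro h0
  rw [mem_supp, coeff_sub, coeff_degreeFilter, if_pos h0, sub_self] at h
  exact h rfl

/-- Contractions preserve `|β| + j`, so a homogeneous right factor shifts degrees by exactly
`D.deg`. -/
theorem degree_of_mem_supp_mul {Q D : HDhat k n} (hD : D.IsHomogeneous)
    {e : (Fin n →₀ ℕ) × (Fin n →₀ ℕ) × ℕ} (h : e ∈ (Q * D).supp) :
    ∃ f ∈ Q.supp, e.2.2 + e.2.1.degree = f.2.2 + f.2.1.degree + D.deg := by
  obtain ⟨f, hf, g, hg, γ, hc⟩ := exists_of_mem_supp_mul h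
  refine ⟨f, hf, ?_⟩
  rw [hc.degree_eq, ← hD g hg]
  simp only [Prod.snd_add, Prod.fst_add, map_add]
  omega

/-- The part of a division of a homogeneous operator in its degree is again a division. -/
theorem isDivision_degreeFilter {D Q : Fin r → HDhat k n} {P R : HDhat k n}
    (h : IsDivision lt D P Q R) (hP : P.IsHomogeneous) (hD : ∀ j, (D j).IsHomogeneous) :
    IsDivision lt D P (fun j => degreeFilter (fun m => m + (D j).deg = P.deg) (Q j))
      (degreeFilter (fun m => m = P.deg) R) := by
  obtain ⟨hQ, hR⟩ := exponent_cells_of_isDivision h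
  refine ⟨coeff_ext fun e => ?_, fun j _ f hf => hQ j f (of_mem_supp_degreeFilter hf).1,
    fun _ f hf => hR (of_mem_supp_degreeFilter hf).1⟩
  rw [coeff_add, coeff_degreeFilter, coeff_sum]
  by_cases he : e.2.2 + e.2.1.degree = P.deg
  · rw [if_pos he]
    conv_lhs => rw [h.eq_sum_add, coeff_add, coeff_sum]
    congr 1
    refine Finset.sum_congr rfl fun j _ => ?_
    -- The discarded part of `Q j` lives in degrees `m` with `m + (D j).deg ≠ P.deg`, so its product
    -- with `D j` misses degree `P.deg`.
    rw [← sub_eq_zero, ← coeff_sub, ← sub_mul]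
    by_contra h0
    obtain ⟨f, hf, h1⟩ := degree_of_mem_supp_mul (hD j) h0
    exact of_mem_supp_sub_degreeFilter hf (h1.symm.trans he)
  · have h1 : coeff e P = 0 := by
      by_contra h0
      exact he ((add_comm _ _).trans (hP e h0))
    rw [if_neg he, h1, add_zero, Finset.sum_eq_zero]
    intro j _
    by_contra h0
    obtain ⟨f, hf, h2⟩ := degree_of_mem_supp_mul (hD j) h0
    exact he (h2.trans (of_mem_supp_degreeFilter hf).2)

end HDhat

theorem mainTheorem6 {k : Type*} [Field k] {n r : ℕ}
    (lt : (Fin n →₀ ℕ) × (Fin n →₀ ℕ) → (Fin n →₀ ℕ) × (Fin n →₀ ℕ) → Prop)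
    (hlt : IsAdmissibleOrder lt) (D : Fin r → HDhat k n) (hD : ∀ j, D j ≠ 0) :
    (∀ P : HDhat k n, ∃! QR : (Fin r → HDhat k n) × HDhat k n, IsDivision lt D P QR.1 QR.2) ∧
    (∀ (P : HDhat k n) (Q : Fin r → HDhat k n) (R : HDhat k n), IsDivision lt D P Q R →
      P.IsHomogeneous → (∀ j, (D j).IsHomogeneous) →
        (∀ j, (Q j).IsHomogeneous) ∧ R.IsHomogeneous) := by
  refine ⟨fun P => ?_, fun P Q R h hP hDh => ?_⟩
  · obtain ⟨Q, R, h⟩ := HDhat.exists_isDivision hlt D hD P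
    refine ⟨(Q, R), h, fun QR h' => ?_⟩
    obtain ⟨h1, h2⟩ := HDhat.isDivision_unique hlt hD h' h
    exact Prod.ext h1 h2
  -- By uniqueness the division equals its own filtered part, where only one degree survives in each
  -- component.
  · obtain ⟨h1, h2⟩ := HDhat.isDivision_unique hlt hD h (HDhat.isDivision_degreeFilter h hP hDh)
    constructor
    · intro j
      rw [h1]
      refine HDhat.isHomogeneous_of_degree_eq fun e he f hf => ?_
      have he' := (HDhat.of_mem_supp_degreeFilter he).2
      have hf' := (HDhat.of_mem_supp_degreeFilter hf).2
      exact add_right_cancel (he'.trans hf'.symm)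
    · rw [h2]
      refine HDhat.isHomogeneous_of_degree_eq fun e he f hf => ?_
      exact (HDhat.of_mem_supp_degreeFilter he).2.trans (HDhat.of_mem_supp_degreeFilter hf).2.symm
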